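/- Let $q$ be a prime power, let $n\ge 1$ and $m\ge 0$ be integers, and let $\mathcal Q_m(n)=\mathbb F_q[x_1,\dots,x_n]/(x_1^{q^m},\dots,x_n^{q^m})$, graded by $\deg x_i=1$. The group $\mathrm{GL}_n(\mathbb F_q)$ acts on $\mathbb F_q[x_1,\dots,x_n]$ by the linear substitutions $\sigma x_j=\sum_{i=1}^n\sigma_{ij}x_i$, $\sigma=(\sigma_{ij})$; this preserves the ideal $(x_1^{q^m},\dots,x_n^{q^m})$ and so induces an action on $\mathcal Q_m(n)$. Let $\mathrm B_n\subset \mathrm{GL}_n(\mathbb F_q)$ be the Borel subgroup of invertible upper triangular matrices, and let $\mathcal Q_m(n)^{\mathrm B_n}$ be the graded $\mathbb F_q$-vector space of $\mathrm B_n$-invariants. For a weak composition $\alpha=(\alpha_1,\dots,\alpha_\ell)$ of $k$ (a sequence of non-negative integers with sum $k$) with partial sums $A_i=\alpha_1+\dots+\alpha_i$, define the $(q,t)$-multinomial coefficient, as a power series in $t$, by $$\begin{bmatrix}k\\ \alpha\end{bmatrix}_{q,t}=\frac{\prod_{j=0}^{k-1}\bigl(1-t^{q^k-q^j}\bigr)}{\prod_{i=1}^{\ell}\prod_{j=1}^{\alpha_i}\bigl(1-t^{q^{A_i}-q^{A_i-j}}\bigr)}.$$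 Then the Hilbert series of $\mathcal Q_m(n)^{\mathrm B_n}$ is $$\sum_{d\ge 0}\dim_{\mathbb F_q}\bigl(\mathcal Q_m(n)^{\mathrm B_n}\bigr)_d\,t^d=C_{1^n,m}(t):=\sum_{\substack{\beta\in\{0,1\}^n\\ |\beta|\le m}}t^{e(m,1^n,\beta)}\begin{bmatrix}m\\ \beta,\,m-|\beta|\end{bmatrix}_{q,t},$$ where $|\beta|=\beta_1+\dots+\beta_n$, $B_i=\beta_1+\dots+\beta_i$, $e(m,1^n,\beta)=\sum_{i=1}^n(1-\beta_i)(q^m-q^{B_i})$, and $(\beta,m-|\beta|)$ denotes the weak composition $(\beta_1,\dots,\beta_n,m-|\beta|)$ of $m$. -/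

import Mathlib

noncomputable section

namespace BorelTrunc

open MvPolynomial

/-! ## The truncated polynomial ring and the action of `GL_n(F)` -/

section Substitution

variable {F : Type*} [Field F] {n : ℕ}

/-- Linear substitution `x_j ↦ ∑ i, σ_{ij} x_i` on polynomials. -/
def subst (σ : Matrix (Fin n) (Fin n) F) : MvPolynomial (Fin n) F →ₐ[F] MvPolynomial (Fin n) F :=
  aeval fun j => ∑ i, C (σ i j) * X i

theorem subst_X (σ : Matrix (Fin n) (Fin n) F) (j : Fin n) :
    subst σ (X j) = ∑ i, C (σ i j) * X i := by
  simp [subst]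

theorem subst_one : subst (1 : Matrix (Fin n) (Fin n) F) = AlgHom.id F _ := by
  ext1 j
  simp [subst_X, Matrix.one_apply, apply_ite C, ite_mul]

theorem subst_mul (σ τ : Matrix (Fin n) (Fin n) F) :
    subst (σ * τ) = (subst σ).comp (subst τ) := by
  ext1 j
  have hC : ∀ a : F, subst σ (C a) = C a := fun a => (subst σ).commutes a
  simp only [AlgHom.comp_apply, subst_X, map_sum, map_mul, hC, Matrix.mul_apply,
    Finset.sum_mul, Finset.mul_sum]
  rw [Finset.sum_comm]
  refine Finset.sum_congr rfl fun i _ => Finset.sum_congr rfl fun k _ => ?_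
  ring

end Substitution

section Action

variable (F : Type*) [Field F] [Fintype F] (m n : ℕ)

/-- The ideal `(x_1^{q^m}, …, x_n^{q^m})` of `F[x_1, …, x_n]`, where `q = |F|`. -/
def truncIdeal : Ideal (MvPolynomial (Fin n) F) :=
  Ideal.span (Set.range fun i : Fin n => (X i : MvPolynomial (Fin n) F) ^ (Fintype.card F ^ m))

/-- The truncated polynomial ring `F[x_1, …, x_n] / (x_1^{q^m}, …, x_n^{q^m})`. -/
abbrev TruncRing : Type _ := MvPolynomial (Fin n) F ⧸ truncIdeal F m n

variable {F n}

theorem truncIdeal_le_comap (σ : Matrix (Fin n) (Fin n) F) :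
    truncIdeal F m n ≤ (truncIdeal F m n).comap (subst σ) := by
  obtain ⟨p, hp⟩ := CharP.exists F
  obtain ⟨k, hprime, hk⟩ := FiniteField.card F p
  have : Fact p.Prime := ⟨hprime⟩
  have : ExpChar (MvPolynomial (Fin n) F) p := ExpChar.prime hprime
  refine Ideal.span_le.2 ?_
  rintro _ ⟨j, rfl⟩
  change subst σ (X j ^ _) ∈ truncIdeal F m n
  rw [map_pow, subst_X, hk, ← pow_mul, sum_pow_char_pow]
  refine Ideal.sum_mem _ fun i _ => ?_
  rw [mul_pow]
  refine Ideal.mul_mem_left _ _ (Ideal.subset_span ⟨i, ?_⟩)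
  simp only [hk, ← pow_mul]

/-- The linear substitution induced on the truncated polynomial ring. -/
def truncSubst (σ : Matrix (Fin n) (Fin n) F) : TruncRing F m n →ₐ[F] TruncRing F m n :=
  Ideal.quotientMapₐ _ (subst σ) (truncIdeal_le_comap m σ)

theorem truncSubst_mk (σ : Matrix (Fin n) (Fin n) F) (f : MvPolynomial (Fin n) F) :
    truncSubst m σ (Ideal.Quotient.mk (truncIdeal F m n) f) =
      Ideal.Quotient.mk (truncIdeal F m n) (subst σ f) := rfl

variable (F n)

/-- The representation of `GL_n(F)` on the truncated polynomial ring by linear substitutions. -/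
def truncRep : Representation F (Matrix.GeneralLinearGroup (Fin n) F) (TruncRing F m n) where
  toFun σ := (truncSubst m (σ : Matrix (Fin n) (Fin n) F)).toLinearMap
  map_one' := by
    refine LinearMap.ext fun x => ?_
    obtain ⟨f, rfl⟩ := Ideal.Quotient.mk_surjective x
    change truncSubst m ((1 : Matrix.GeneralLinearGroup (Fin n) F) : Matrix (Fin n) (Fin n) F)
      (Ideal.Quotient.mk _ f) = Ideal.Quotient.mk _ f
    rw [truncSubst_mk, Units.val_one, subst_one, AlgHom.id_apply]
  map_mul' σ τ := by
    refine LinearMap.ext fun x => ?_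
    obtain ⟨f, rfl⟩ := Ideal.Quotient.mk_surjective x
    change truncSubst m ((σ * τ : Matrix.GeneralLinearGroup (Fin n) F) : Matrix (Fin n) (Fin n) F)
      (Ideal.Quotient.mk _ f) = truncSubst m (σ : Matrix (Fin n) (Fin n) F)
        (truncSubst m (τ : Matrix (Fin n) (Fin n) F) (Ideal.Quotient.mk _ f))
    rw [truncSubst_mk, truncSubst_mk, truncSubst_mk, Units.val_mul, subst_mul, AlgHom.comp_apply]

/-- The Borel subgroup of `GL_n(F)`: the invertible upper triangular matrices. -/
def borel : Subgroup (Matrix.GeneralLinearGroup (Fin n) F) where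
  carrier := {σ | ∀ i j : Fin n, j < i → (σ : Matrix (Fin n) (Fin n) F) i j = 0}
  one_mem' := fun i j h => by simp [h.ne']
  mul_mem' := fun {σ τ} hσ hτ => by
    have h1 : (σ : Matrix (Fin n) (Fin n) F).BlockTriangular id := fun i j h => hσ i j h
    have h2 : (τ : Matrix (Fin n) (Fin n) F).BlockTriangular id := fun i j h => hτ i j h
    exact fun i j h => (h1.mul h2) h
  inv_mem' := fun {σ} hσ => by
    have h1 : (σ : Matrix (Fin n) (Fin n) F).BlockTriangular id := fun i j h => hσ i j h
    have : Invertible (σ : Matrix (Fin n) (Fin n) F) := σ.invertible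
    intro i j h
    rw [Matrix.coe_units_inv]
    exact Matrix.blockTriangular_inv_of_blockTriangular h1 h

/-- The subspace of invariants of the truncated polynomial ring under the Borel subgroup. -/
def borelInvariants : Submodule F (TruncRing F m n) :=
  Representation.invariants ((truncRep F m n).comp (borel F n).subtype)

/-- The degree `d` component of the truncated polynomial ring (every `x_i` has degree `1`):
the classes of the homogeneous polynomials of degree `d`. -/
def truncDegree (d : ℕ) : Submodule F (TruncRing F m n) :=
  (homogeneousSubmodule (Fin n) F d).map (Ideal.Quotient.mkₐ F (truncIdeal F m n)).toLinearMap

instance finite_truncDegree (d : ℕ) : Module.Finite F (truncDegree F m n d) :=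
  Module.Finite.iff_fg.2 ((homogeneousSubmodule_fg (Fin n) F d).map _)

variable {F m n}

/-- The Hilbert series `∑_d dim_F (M ∩ Q_d) t^d` of a graded subspace `M` of the truncated
polynomial ring `Q`. -/
def hilbertSeries (M : Submodule F (TruncRing F m n)) : PowerSeries ℚ :=
  PowerSeries.mk fun d => (Module.finrank F ↥(M ⊓ truncDegree F m n d) : ℚ)

end Action

/-! ## The `(q,t)`-multinomial coefficients and the series `C_{α,m}(t)` -/

section Series

variable {l : ℕ}

/-- The partial sum `A_i = α_1 + ⋯ + α_i`, the `i`-th part included. -/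
def partialSum (α : Fin l → ℕ) (i : Fin l) : ℕ := ∑ j ∈ Finset.Iic i, α j

/-- The polynomial `1 - t^a`, as a power series. -/
def oneSub (a : ℕ) : PowerSeries ℚ := 1 - PowerSeries.X ^ a

/-- The `(q,t)`-multinomial coefficient of a weak composition `α` of `k`. For `2 ≤ q` every
exponent in the denominator is positive, so the denominator has constant term `1` and
is an invertible power series. -/
def qtMultinomial (q k : ℕ) (α : Fin l → ℕ) : PowerSeries ℚ :=
  (∏ j ∈ Finset.range k, oneSub (q ^ k - q ^ j)) *
    (∏ i : Fin l, ∏ j ∈ Finset.Icc 1 (α i),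
      oneSub (q ^ partialSum α i - q ^ (partialSum α i - j)))⁻¹

/-- The exponent `e(m, α, β) = ∑ i, (α_i - β_i) (q^m - q^{B_i})`. It is used only for `β ≤ α`
with `|β| ≤ m`, where no subtraction is truncated. -/
def expo (q m : ℕ) (α β : Fin l → ℕ) : ℕ :=
  ∑ i, (α i - β i) * (q ^ m - q ^ partialSum β i)

/-- The series `C_{α,m}(t)`; the composition `(β, m - |β|)` is `β` with one part appended. -/
def parabolicSeries (q m : ℕ) (α : Fin l → ℕ) : PowerSeries ℚ :=
  ∑ β ∈ (Finset.Iic α).filter (fun β => ∑ i, β i ≤ m),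
    PowerSeries.X ^ expo q m α β *
      qtMultinomial q m (Fin.snoc β (m - ∑ i, β i) : Fin (l + 1) → ℕ)

end Series

end BorelTrunc

end

/-! Write C_{n,m} for the series. Splitting off β_1 gives, for m ≥ 1, C_{n+1,m}(t) = t^{q^m-1}
C_{n,m}(t) + (1-t^{q^m-1})/(1-t^{q-1}) · C_{n,m-1}(t^q) (`sum_shiftedTerm`), so C_{n,m} is a
polynomial with natural coefficients, `borelPoly`.

The invariants obey this recursion as an upper bound. A class is represented by a reduced
polynomial, all exponents below q^m. Expand a reduced invariant in powers of the first variable x_0,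
with lowest term x_0^a g. The diagonal matrices force q-1 ∣ a. Unless a = q^m-1, the transvections
x_j ↦ x_j + x_0 force g to be a polynomial in the x_j^q (`redInv.card_dvd`), say g = G(x^q) with G
an invariant for m-1. Counting the possible leading coefficients bounds each dimension by the
coefficient of `borelPoly` (`finrank_redInv_le`).

It remains to bound the total dimension below by C_{n,m}(1). For m ≥ 1 let K/F have degree m. The
upper triangular group over F has at least C_{n,m}(1) orbits on K^n (`exists_orbit_invariant`),
hence at least that many independent invariant functions K^n → K. Functions on K^n are reduced
polynomials, and the top homogeneous component of an invariant function is a reduced invariant over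
K (`homogeneousComponent_mem_redInv`). Invariance is a linear condition over F, so the bound
descends from K to F (`finrank_redInv_le_base`). Upper bounds in every degree and a lower bound for
the sum force equality (`finrank_redInv_eq`). -/

noncomputable section

namespace BorelTrunc

open MvPolynomial
open scoped LinearAlgebra.Projectivization

universe u

/-! ## A recursion for the series `C_{1^n,m}` -/

/-- The number `1 + q + ⋯ + q^{m-1}` of lines in an `m`-dimensional space. -/
def lineCount (q m : ℕ) : ℕ := ∑ i ∈ Finset.range m, q ^ i

/-- The polynomials with `C_{n+1,m} = t^{q^m-1} C_{n,m} + [q^m-1]/[q-1] C_{n,m-1}(t^q)`. -/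
def borelPoly (q : ℕ) : ℕ → ℕ → Polynomial ℕ
  | 0, _ => 1
  | n + 1, 0 => borelPoly q n 0
  | n + 1, m + 1 => Polynomial.X ^ (q ^ (m + 1) - 1) * borelPoly q n (m + 1) +
      (∑ k ∈ Finset.range (lineCount q (m + 1)), Polynomial.X ^ ((q - 1) * k)) *
        Polynomial.expand ℕ q (borelPoly q n m)

theorem sub_one_mul_lineCount {q : ℕ} (hq : 1 ≤ q) (m : ℕ) :
    (q - 1) * lineCount q m = q ^ m - 1 := by
  rw [lineCount]
  have h := mul_geom_sum (q : ℤ) m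
  zify [hq, Nat.one_le_pow m q hq]
  exact h

/-- The quotient `(1 - t^{q^m-q^j}) / (1 - t^{q^{j+1}-q^j})`. -/
def geomFactor (q m j : ℕ) : PowerSeries ℚ :=
  ∑ k ∈ Finset.range (lineCount q (m - j)), PowerSeries.X ^ (q ^ j * ((q - 1) * k))

theorem oneSub_mul_geomFactor {q : ℕ} (hq : 1 ≤ q) {m j : ℕ} (h : j ≤ m) :
    oneSub (q ^ (j + 1) - q ^ j) * geomFactor q m j = oneSub (q ^ m - q ^ j) := by
  have e1 : q ^ (j + 1) - q ^ j = q ^ j * (q - 1) := by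
    rw [Nat.mul_sub, pow_succ, mul_one]
  have e2 : q ^ m - q ^ j = (q ^ j * (q - 1)) * lineCount q (m - j) := by
    rw [mul_assoc, sub_one_mul_lineCount hq, Nat.mul_sub, ← pow_add, mul_one,
      Nat.add_sub_cancel' h]
  have e3 : geomFactor q m j = ∑ k ∈ Finset.range (lineCount q (m - j)),
      ((PowerSeries.X : PowerSeries ℚ) ^ (q ^ j * (q - 1))) ^ k :=
    Finset.sum_congr rfl fun k _ => by rw [← pow_mul, mul_assoc]
  rw [e1, e2, e3, oneSub, oneSub, pow_mul (PowerSeries.X : PowerSeries ℚ) (q ^ j * (q - 1))]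
  generalize (PowerSeries.X : PowerSeries ℚ) ^ (q ^ j * (q - 1)) = x
  exact mul_neg_geom_sum x _

theorem constantCoeff_oneSub {a : ℕ} (h : 0 < a) :
    PowerSeries.constantCoeff (oneSub a) = 1 := by
  simp [oneSub, h.ne']

theorem partialSum_eq {l : ℕ} (α : Fin l → ℕ) (i : Fin l) :
    partialSum α i = ∑ j, if j ≤ i then α j else 0 := by
  rw [partialSum, ← Finset.sum_filter]
  congr 1
  ext j
  simp

theorem partialSum_cons_zero {l : ℕ} (a : ℕ) (α : Fin l → ℕ) :
    partialSum (Fin.cons a α : Fin (l + 1) → ℕ) 0 = a := by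
  simp [partialSum_eq]

theorem partialSum_cons_succ {l : ℕ} (a : ℕ) (α : Fin l → ℕ) (i : Fin l) :
    partialSum (Fin.cons a α : Fin (l + 1) → ℕ) i.succ = a + partialSum α i := by
  simp [partialSum_eq, Fin.sum_univ_succ]

theorem partialSum_snoc_castSucc {l : ℕ} (a : ℕ) (α : Fin l → ℕ) (i : Fin l) :
    partialSum (Fin.snoc α a : Fin (l + 1) → ℕ) i.castSucc = partialSum α i := by
  have : ¬ (Fin.last l ≤ i.castSucc) := not_le.2 (Fin.castSucc_lt_last i)
  simp [partialSum_eq, Fin.sum_univ_castSucc, this]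

theorem partialSum_snoc_last {l : ℕ} (a : ℕ) (α : Fin l → ℕ) :
    partialSum (Fin.snoc α a : Fin (l + 1) → ℕ) (Fin.last l) = ∑ i, α i + a := by
  have (i : Fin l) : i.castSucc ≤ Fin.last l := Fin.le_last _
  simp [partialSum_eq, Fin.sum_univ_castSucc, this]

/-- Zero parts contribute empty products, and a part 1 ending at partial sum B contributes the
exponent q^B - q^{B-1}; each B above s is reached by exactly one such part. The offset s serves the
induction on the first part. -/
theorem prod_oneSub_of_le_one (q : ℕ) {l : ℕ} (s : ℕ) (β : Fin l → ℕ) (hβ : ∀ i, β i ≤ 1) :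
    (∏ i, ∏ j ∈ Finset.Icc 1 (β i), oneSub (q ^ (s + partialSum β i) -
      q ^ (s + partialSum β i - j))) =
      ∏ j ∈ Finset.range (∑ i, β i), oneSub (q ^ (s + j + 1) - q ^ (s + j)) := by
  induction l generalizing s with
  | zero => simp
  | succ l ih =>
    obtain ⟨a, β', rfl⟩ : ∃ (a : ℕ) (β' : Fin l → ℕ), β = Fin.cons a β' :=
      ⟨β 0, Fin.tail β, (Fin.cons_self_tail β).symm⟩
    have ha : a ≤ 1 := by simpa using hβ 0
    have hβ' : ∀ i, β' i ≤ 1 := fun i => by simpa using hβ i.succ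
    rw [Fin.prod_univ_succ, Fin.sum_univ_succ]
    simp only [partialSum_cons_zero, partialSum_cons_succ, Fin.cons_zero, Fin.cons_succ]
    simp_rw [← add_assoc]
    rw [ih (s + a) β' hβ', Finset.prod_range_add]
    congr 1
    · interval_cases a <;> simp
    · simp_rw [add_assoc]

/-- The last part m - k cancels the numerator factors with k ≤ j < m; the others divide in pairs. -/
theorem qtMultinomial_of_le_one {q : ℕ} (hq : 2 ≤ q) {l m : ℕ} (β : Fin l → ℕ)
    (hβ : ∀ i, β i ≤ 1) (hm : ∑ i, β i ≤ m) :
    qtMultinomial q m (Fin.snoc β (m - ∑ i, β i) : Fin (l + 1) → ℕ) =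
      ∏ j ∈ Finset.range (∑ i, β i), geomFactor q m j := by
  set k := ∑ i, β i with hk
  have h1 := prod_oneSub_of_le_one q 0 β hβ
  simp only [zero_add, ← hk] at h1
  have hlast : (∏ j ∈ Finset.Icc 1 (m - k), oneSub (q ^ m - q ^ (m - j))) =
      ∏ j ∈ Finset.Ico k m, oneSub (q ^ m - q ^ j) := by
    refine Finset.prod_nbij' (fun j => m - j) (fun j => m - j) ?_ ?_ ?_ ?_ ?_ <;>
      intro j hj <;> simp only [Finset.mem_Icc, Finset.mem_Ico] at * <;> omega
  have hden : (∏ i : Fin (l + 1), ∏ j ∈ Finset.Icc 1 ((Fin.snoc β (m - k) : Fin (l + 1) → ℕ) i),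
      oneSub (q ^ partialSum (Fin.snoc β (m - k) : Fin (l + 1) → ℕ) i -
        q ^ (partialSum (Fin.snoc β (m - k) : Fin (l + 1) → ℕ) i - j))) =
      (∏ j ∈ Finset.range k, oneSub (q ^ (j + 1) - q ^ j)) *
        ∏ j ∈ Finset.Ico k m, oneSub (q ^ m - q ^ j) := by
    rw [Fin.prod_univ_castSucc]
    simp only [partialSum_snoc_castSucc, partialSum_snoc_last, Fin.snoc_castSucc, Fin.snoc_last,
      ← hk, Nat.add_sub_cancel' hm]
    rw [h1, hlast]
  rw [qtMultinomial, hden, eq_comm, PowerSeries.eq_mul_inv_iff_mul_eq]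
  · rw [← mul_assoc, ← Finset.prod_mul_distrib, ← Finset.prod_range_mul_prod_Ico _ hm]
    congr 1
    refine Finset.prod_congr rfl fun j hj => ?_
    rw [mul_comm, oneSub_mul_geomFactor (by omega) ((Finset.mem_range.1 hj).le.trans hm)]
  · rw [map_mul, map_prod, map_prod, Finset.prod_eq_one, Finset.prod_eq_one, one_mul]
    · exact one_ne_zero
    · intro j hj
      exact constantCoeff_oneSub (Nat.sub_pos_of_lt
        (Nat.pow_lt_pow_right (by omega) (Finset.mem_Ico.1 hj).2))
    · intro j _
      exact constantCoeff_oneSub (Nat.sub_pos_of_lt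
        (Nat.pow_lt_pow_right (by omega) (Nat.lt_succ_self j)))

/-- The summand of `C_{1^n,m}`, with all partial sums shifted by `s`. -/
def shiftedTerm (q m s : ℕ) {l : ℕ} (β : Fin l → ℕ) : PowerSeries ℚ :=
  if s + ∑ i, β i ≤ m then
    PowerSeries.X ^ (∑ i, (1 - β i) * (q ^ m - q ^ (s + partialSum β i))) *
      ∏ j ∈ Finset.range (∑ i, β i), geomFactor q m (s + j)
  else 0

theorem shiftedTerm_cons_zero (q m s : ℕ) {l : ℕ} (β : Fin l → ℕ) :
    shiftedTerm q m s (Fin.cons 0 β : Fin (l + 1) → ℕ) =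
      PowerSeries.X ^ (q ^ m - q ^ s) * shiftedTerm q m s β := by
  simp only [shiftedTerm, Fin.sum_univ_succ, Fin.cons_zero, Fin.cons_succ, partialSum_cons_zero,
    partialSum_cons_succ, zero_add, add_zero, mul_ite, mul_zero, Nat.sub_zero, one_mul]
  rw [pow_add, mul_assoc]

theorem shiftedTerm_cons_one (q m s : ℕ) {l : ℕ} (β : Fin l → ℕ) :
    shiftedTerm q m s (Fin.cons 1 β : Fin (l + 1) → ℕ) =
      geomFactor q m s * shiftedTerm q m (s + 1) β := by
  simp only [shiftedTerm, Fin.sum_univ_succ, Fin.cons_zero, Fin.cons_succ, partialSum_cons_zero,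
    partialSum_cons_succ, zero_add, mul_ite, mul_zero, Nat.sub_self, zero_mul, add_assoc]
  congr 1
  rw [Finset.prod_range_add]
  simp only [Finset.range_one, Finset.prod_singleton, add_zero]
  ring

theorem sum_Iic_one_succ {l : ℕ} (f : (Fin (l + 1) → ℕ) → PowerSeries ℚ) :
    ∑ β ∈ Finset.Iic (fun _ => 1 : Fin (l + 1) → ℕ), f β =
      (∑ β ∈ Finset.Iic (fun _ => 1 : Fin l → ℕ), f (Fin.cons 0 β)) +
        ∑ β ∈ Finset.Iic (fun _ => 1 : Fin l → ℕ), f (Fin.cons 1 β) := by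
  have : ∑ β ∈ Finset.Iic (fun _ => 1 : Fin (l + 1) → ℕ), f β =
      ∑ x ∈ Finset.range 2 ×ˢ Finset.Iic (fun _ => 1 : Fin l → ℕ), f (Fin.cons x.1 x.2) := by
    refine Finset.sum_nbij' (fun β => (β 0, Fin.tail β)) (fun x => Fin.cons x.1 x.2) ?_ ?_ ?_ ?_ ?_
    · intro β hβ
      rw [Finset.mem_Iic] at hβ
      exact Finset.mem_product.2 ⟨Finset.mem_range.2 (Nat.lt_succ_of_le (hβ 0)),
        Finset.mem_Iic.2 fun i => hβ i.succ⟩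
    · intro x hx
      rw [Finset.mem_product, Finset.mem_range, Finset.mem_Iic] at hx
      exact Finset.mem_Iic.2 fun i => by
        refine Fin.cases ?_ (fun i => ?_) i
        · simpa using Nat.lt_succ_iff.1 hx.1
        · simpa using hx.2 i
    · intro β _
      exact Fin.cons_self_tail β
    · intro x _
      simp
    · intro β _
      simp only [Fin.cons_self_tail]
  rw [this, Finset.sum_product, Finset.sum_range_succ, Finset.sum_range_one]

/-- Induction on the first part: 0 keeps the shift s, 1 raises it to s + 1. A shift by s amounts to
replacing t by t^{q^s} and m by m - s, which is where the substitution t ↦ t^q of the recursion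
comes from. -/
theorem sum_shiftedTerm (q : ℕ) {m : ℕ} (l s : ℕ) (hs : s ≤ m) :
    ∑ β ∈ Finset.Iic (fun _ => 1 : Fin l → ℕ), shiftedTerm q m s β =
      Polynomial.aeval (PowerSeries.X ^ (q ^ s) : PowerSeries ℚ) (borelPoly q l (m - s)) := by
  induction l generalizing s with
  | zero =>
    have : Finset.Iic (fun _ => 1 : Fin 0 → ℕ) = {fun _ => 1} := by
      ext x
      simp [Subsingleton.elim x fun _ => 1]
    simp [borelPoly, this, shiftedTerm, hs]
  | succ l ih =>
    rw [sum_Iic_one_succ]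
    simp_rw [shiftedTerm_cons_zero, shiftedTerm_cons_one, ← Finset.mul_sum]
    rw [ih s hs]
    rcases hs.eq_or_lt with rfl | hlt
    -- For s = m a first part 1 is impossible: its geometric factor is an empty sum.
    · simp [borelPoly, geomFactor, lineCount]
    · rw [ih (s + 1) hlt]
      obtain ⟨r, rfl⟩ : ∃ r, m = s + 1 + r := ⟨m - (s + 1), by omega⟩
      have e1 : s + 1 + r - s = r + 1 := by omega
      have e2 : s + 1 + r - (s + 1) = r := by omega
      have e3 : q ^ (s + 1 + r) - q ^ s = q ^ s * (q ^ (r + 1) - 1) := by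
        rw [Nat.mul_sub, ← pow_add, mul_one]
        congr 2
        omega
      rw [e1, e2, borelPoly, map_add, map_mul, map_mul, map_sum, Polynomial.expand_aeval,
        geomFactor, e1, e3]
      simp only [map_pow, Polynomial.aeval_X, ← pow_mul, ← pow_succ]

theorem parabolicSeries_one {q : ℕ} (hq : 2 ≤ q) (m n : ℕ) :
    parabolicSeries q m (fun _ : Fin n => 1) =
      PowerSeries.mk fun d => ((borelPoly q n m).coeff d : ℚ) := by
  have h := sum_shiftedTerm q n 0 (Nat.zero_le m)
  rw [Nat.sub_zero, pow_zero, pow_one] at h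
  have h2 : Polynomial.aeval (PowerSeries.X : PowerSeries ℚ) (borelPoly q n m) =
      PowerSeries.mk fun d => ((borelPoly q n m).coeff d : ℚ) := by
    ext d
    rw [PowerSeries.coeff_mk]
    induction borelPoly q n m using Polynomial.induction_on' with
    | add f g hf hg => simp only [map_add, hf, hg, Polynomial.coeff_add, Nat.cast_add]
    | monomial k a =>
      rw [Polynomial.aeval_monomial, eq_natCast, ← nsmul_eq_mul, map_nsmul,
        PowerSeries.coeff_X_pow, Polynomial.coeff_monomial]
      simp [eq_comm]
  rw [← h2, ← h, parabolicSeries, Finset.sum_filter]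
  refine Finset.sum_congr rfl fun β hβ => ?_
  rw [Finset.mem_Iic] at hβ
  simp only [shiftedTerm, zero_add, expo]
  split_ifs with hm
  · rw [qtMultinomial_of_le_one hq β hβ hm]
  · rfl

/-! ## Orbits of the Borel subgroup on tuples of vectors -/

theorem card_projectivization {F : Type*} [Field F] [Fintype F] (V : Type*)
    [AddCommGroup V] [Module F V] [Fintype V] {m : ℕ} (h : Module.finrank F V = m) :
    Nat.card (ℙ F V) = lineCount (Fintype.card F) m := by
  rw [Projectivization.card_of_finrank F V h, lineCount, Nat.card_eq_fintype_card]

theorem eval_one_borelPoly_succ_succ (q n m : ℕ) :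
    (borelPoly q (n + 1) (m + 1)).eval 1 =
      (borelPoly q n (m + 1)).eval 1 + lineCount q (m + 1) * (borelPoly q n m).eval 1 := by
  simp [borelPoly, Polynomial.eval_finsetSum, Polynomial.expand_eval]

/-- There are at least `C_{n,m}(1)` orbits of the upper triangular matrices on `n`-tuples of vectors
of an `m`-dimensional space: they are separated by a surjection onto a set of this size. -/
theorem exists_orbit_invariant {F : Type*} [Field F] [Fintype F] (n : ℕ) :
    ∀ (m : ℕ) (V : Type u) [AddCommGroup V] [Module F V] [Finite V],
      Module.finrank F V = m →
      ∃ (Z : Type u) (_ : Finite Z) (θ : (Fin n → V) → Z),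
        Nat.card Z = (borelPoly (Fintype.card F) n m).eval 1 ∧ Function.Surjective θ ∧
        ∀ σ : Matrix (Fin n) (Fin n) F, (∀ i j, j < i → σ i j = 0) → (∀ i, σ i i ≠ 0) →
          ∀ v, θ (fun j => ∑ i, σ i j • v i) = θ v := by
  induction n with
  | zero =>
    intro m V _ _ _ _
    refine ⟨PUnit, inferInstance, fun _ => PUnit.unit, by simp [borelPoly], fun z => ⟨0, rfl⟩, ?_⟩
    intros
    rfl
  | succ n ih =>
    intro m V _ _ _ hV
    have hsplit (σ : Matrix (Fin (n + 1)) (Fin (n + 1)) F) (hσ : ∀ i j, j < i → σ i j = 0)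
        (v : Fin (n + 1) → V) : ∑ i, σ i 0 • v i = σ 0 0 • v 0 := by
      rw [Fin.sum_univ_succ, Finset.sum_eq_zero, add_zero]
      intro i _
      rw [hσ _ _ (Fin.succ_pos i), zero_smul]
    obtain ⟨Z₀, hZ₀, θ₀, hc₀, hs₀, hi₀⟩ := ih m V hV
    cases m with
    | zero =>
      have : Subsingleton V := Module.finrank_zero_iff.1 hV
      refine ⟨Z₀, hZ₀, fun v => θ₀ (Fin.tail v), by rw [hc₀, borelPoly], fun z => ?_, ?_⟩
      · obtain ⟨w, rfl⟩ := hs₀ z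
        exact ⟨Fin.cons 0 w, by simp⟩
      · intros
        congr 1
        exact Subsingleton.elim _ _
    | succ m =>
      have hq (ℓ : ℙ F V) : Module.finrank F (V ⧸ ℓ.submodule) = m := by
        have := Submodule.finrank_quotient_add_finrank ℓ.submodule
        rw [ℓ.finrank_submodule, hV] at this
        omega
      have : Finite (ℙ F V) := inferInstance
      have hfin (ℓ : ℙ F V) : Finite (V ⧸ ℓ.submodule) :=
        Finite.of_surjective _ (Submodule.mkQ_surjective ℓ.submodule)
      choose Z hZ θ hc hs hi using fun ℓ : ℙ F V => ih m (V ⧸ ℓ.submodule) (hq ℓ)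
      classical
      -- An upper triangular matrix only rescales v_0 and changes the later vectors by multiples of
      -- v_0 besides acting on them. So if v_0 ≠ 0, its line and the remaining vectors modulo that
      -- line carry the invariant; if v_0 = 0, the remaining vectors alone do.
      let Θ : (Fin (n + 1) → V) → Z₀ ⊕ (Σ ℓ : ℙ F V, Z ℓ) := fun v =>
        if h : v 0 = 0 then Sum.inl (θ₀ (Fin.tail v))
        else Sum.inr ⟨Projectivization.mk F (v 0) h,
          θ _ fun j => Submodule.mkQ _ (v j.succ)⟩
      refine ⟨Z₀ ⊕ (Σ ℓ : ℙ F V, Z ℓ), inferInstance, Θ, ?_, ?_, ?_⟩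
      · have := Fintype.ofFinite (ℙ F V)
        have := Fintype.ofFinite V
        rw [Nat.card_sum, Nat.card_sigma, hc₀, eval_one_borelPoly_succ_succ]
        simp_rw [hc]
        rw [Finset.sum_const, Finset.card_univ, ← Nat.card_eq_fintype_card (α := ℙ F V),
          card_projectivization V hV, smul_eq_mul]
      · rintro (z | ⟨ℓ, z⟩)
        · obtain ⟨w, rfl⟩ := hs₀ z
          exact ⟨Fin.cons 0 w, by simp [Θ]⟩
        · induction ℓ with
          | h u hu =>
            obtain ⟨w, rfl⟩ := hs _ z
            choose w' hw' using fun j => Submodule.mkQ_surjective _ (w j)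
            refine ⟨Fin.cons u w', ?_⟩
            have : Θ (Fin.cons u w') = Sum.inr ⟨Projectivization.mk F u hu,
                θ _ fun j => Submodule.mkQ _ (w' j)⟩ :=
              dif_neg (show ¬(Fin.cons u w' : Fin (n + 1) → V) 0 = 0 from hu)
            rw [this]
            congr 3
            exact funext hw'
      · intro σ hσ hd v
        have hτ1 : ∀ i j : Fin n, j < i → σ.submatrix Fin.succ Fin.succ i j = 0 :=
          fun i j h => hσ _ _ (Fin.succ_lt_succ_iff.2 h)
        have hτ2 : ∀ i : Fin n, σ.submatrix Fin.succ Fin.succ i i ≠ 0 := fun i => hd _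
        by_cases h : v 0 = 0
        · have h' : ∑ i, σ i 0 • v i = 0 := by rw [hsplit σ hσ, h, smul_zero]
          simp only [Θ, h', h, dif_pos]
          congr 1
          refine Eq.trans ?_ (hi₀ _ hτ1 hτ2 _)
          congr 1
          funext j
          rw [Fin.tail, Fin.sum_univ_succ, h, smul_zero, zero_add]
          rfl
        · have h' : ∑ i, σ i 0 • v i ≠ 0 := by
            rw [hsplit σ hσ]
            exact smul_ne_zero (hd 0) h
          simp only [Θ, h', h, dif_neg, not_false_eq_true]
          congr 1
          -- The two lines are generalized so that their equality can be substituted in the type of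
          -- θ.
          have key : ∀ ℓ' ℓ : ℙ F V, ℓ' = ℓ → v 0 ∈ ℓ.submodule →
              (⟨ℓ', θ ℓ' fun j => Submodule.mkQ _ (∑ i, σ i j.succ • v i)⟩ : Σ ℓ, Z ℓ) =
                ⟨ℓ, θ ℓ fun j => Submodule.mkQ _ (v j.succ)⟩ := by
            rintro ℓ' ℓ rfl hv
            congr 1
            refine Eq.trans ?_ (hi ℓ' _ hτ1 hτ2 _)
            congr 1
            funext j
            have h0 : ℓ'.submodule.mkQ (v 0) = 0 := by simpa using hv
            rw [Fin.sum_univ_succ, map_add, map_smul, h0, smul_zero, zero_add, map_sum]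
            simp only [map_smul, Matrix.submatrix_apply]
          refine key _ _ ?_ ?_
          · rw [Projectivization.mk_eq_mk_iff']
            exact ⟨σ 0 0, (hsplit σ hσ v).symm⟩
          · rw [Projectivization.submodule_mk]
            exact Submodule.mem_span_singleton_self _

/-! ## Reduced invariants -/

/-- Rank-nullity for κ 0 on X, then induction on its kernel. The value κ a x is a leading
coefficient: only elements killed by all earlier κ b need to be controlled. -/
theorem finrank_le_sum_of_leading {K M W : Type*} [Field K] [AddCommGroup M] [Module K M]
    [AddCommGroup W] [Module K W] (N : ℕ) (X : Submodule K M) [FiniteDimensional K X]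
    (κ : ℕ → M →ₗ[K] W) (L : ℕ → Submodule K W) (hfin : ∀ a, FiniteDimensional K (L a))
    (h0 : ∀ x ∈ X, (∀ a < N, κ a x = 0) → x = 0)
    (hL : ∀ a < N, ∀ x ∈ X, (∀ b < a, κ b x = 0) → κ a x ∈ L a) :
    Module.finrank K X ≤ ∑ a ∈ Finset.range N, Module.finrank K (L a) := by
  induction N generalizing X κ L with
  | zero =>
    have : X = ⊥ := (Submodule.eq_bot_iff X).2 fun x hx => h0 x hx (by simp)
    simp [this]
  | succ N ih =>
    have hX' : FiniteDimensional K ↥(X ⊓ LinearMap.ker (κ 0)) :=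
      Submodule.finiteDimensional_of_le (inf_le_left (b := LinearMap.ker (κ 0)))
    have h1 := ih (X ⊓ LinearMap.ker (κ 0)) (fun a => κ (a + 1)) (fun a => L (a + 1))
      (fun a => hfin _) (fun x hx h => h0 x hx.1 fun a ha => by
        rcases a with _ | a
        · exact hx.2
        · exact h a (by omega))
      (fun a ha x hx h => hL (a + 1) (by omega) x hx.1 fun b hb => by
        rcases b with _ | b
        · exact hx.2
        · exact h b (by omega))
    rw [Finset.sum_range_succ']
    have h2 := LinearMap.finrank_range_add_finrank_ker ((κ 0).domRestrict X)
    have h3 : Module.finrank K (LinearMap.range ((κ 0).domRestrict X)) ≤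
        Module.finrank K (L 0) := by
      have := hfin 0
      refine Submodule.finrank_mono ?_
      rintro _ ⟨x, rfl⟩
      exact hL 0 (by omega) x x.2 (by simp)
    have h4 : Module.finrank K (LinearMap.ker ((κ 0).domRestrict X)) ≤
        Module.finrank K ↥(X ⊓ LinearMap.ker (κ 0)) := by
      refine LinearMap.finrank_le_finrank_of_injective
        (f := LinearMap.codRestrict _ (X.subtype ∘ₗ Submodule.subtype _) ?_) ?_
      · intro x
        exact ⟨x.1.2, x.2⟩
      · intro x y h
        have h' := congrArg Subtype.val h
        exact Subtype.ext (Subtype.ext h')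
    omega

/-- Invertible upper triangular matrices. -/
def IsUpper {F : Type*} [Field F] {n : ℕ} (σ : Matrix (Fin n) (Fin n) F) : Prop :=
  (∀ i j, j < i → σ i j = 0) ∧ ∀ i, σ i i ≠ 0

/-- The homogeneous polynomials over `K` with all exponents less than `Q` whose classes modulo
`(x_1^Q, …, x_n^Q)` are invariant under the upper triangular matrices over `F`. -/
def redInv (F K : Type*) [Field F] [Field K] [Algebra F K] (Q n d : ℕ) :
    Submodule K (MvPolynomial (Fin n) K) where
  carrier := {f | (∀ α, coeff α f ≠ 0 → ∀ i, α i < Q) ∧ f.IsHomogeneous d ∧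
    ∀ σ : Matrix (Fin n) (Fin n) F, IsUpper σ → ∀ α : Fin n →₀ ℕ, (∀ i, α i < Q) →
      coeff α (subst (σ.map (algebraMap F K)) f) = coeff α f}
  zero_mem' := ⟨by simp, isHomogeneous_zero _ _ _, by simp⟩
  add_mem' := by
    rintro f g ⟨f1, f2, f3⟩ ⟨g1, g2, g3⟩
    refine ⟨fun α h => ?_, f2.add g2, fun σ hσ α hα => ?_⟩
    · by_cases hf : coeff α f = 0
      · exact g1 α fun hg => h (by rw [coeff_add, hf, hg, add_zero])
      · exact f1 α hf
    · rw [map_add, coeff_add, coeff_add, f3 σ hσ α hα, g3 σ hσ α hα]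
  smul_mem' := by
    rintro c f ⟨f1, f2, f3⟩
    refine ⟨fun α h => f1 α fun hf => h (by rw [coeff_smul, hf, smul_zero]), ?_, ?_⟩
    · exact (homogeneousSubmodule (Fin n) K d).smul_mem c f2
    · intro σ hσ α hα
      rw [map_smul, coeff_smul, coeff_smul, f3 σ hσ α hα]

instance finite_redInv (F K : Type*) [Field F] [Field K] [Algebra F K] (Q n d : ℕ) :
    FiniteDimensional K (redInv F K Q n d) := by
  have : FiniteDimensional K (homogeneousSubmodule (Fin n) K d) :=
    Module.Finite.iff_fg.2 (homogeneousSubmodule_fg (Fin n) K d)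
  have hle : redInv F K Q n d ≤ homogeneousSubmodule (Fin n) K d := fun f hf => hf.2.1
  exact Submodule.finiteDimensional_of_le hle

/-! ### Substitutions seen in powers of the first variable -/

section Subst

variable {K : Type*} [Field K] {n : ℕ}

theorem subst_C (σ : Matrix (Fin n) (Fin n) K) (a : K) : subst σ (C a) = C a :=
  (subst σ).commutes a

/-- A block diagonal matrix scales x_0 and mixes the other variables among themselves, so it acts on
each coefficient of x_0^k separately. -/
theorem coeff_finSuccEquiv_subst (σ : Matrix (Fin (n + 1)) (Fin (n + 1)) K)
    (τ : Matrix (Fin n) (Fin n) K) (h0 : ∀ j : Fin n, σ 0 j.succ = 0)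
    (h1 : ∀ i : Fin n, σ i.succ 0 = 0) (hτ : ∀ i j : Fin n, σ i.succ j.succ = τ i j)
    (f : MvPolynomial (Fin (n + 1)) K) (k : ℕ) :
    (finSuccEquiv K n (subst σ f)).coeff k =
      C (σ 0 0 ^ k) * subst τ ((finSuccEquiv K n f).coeff k) := by
  have hC (a : K) : finSuccEquiv K n (C a) = Polynomial.C (C a) :=
    (finSuccEquiv K n).commutes a
  induction f using MvPolynomial.induction_on generalizing k with
  | C a =>
    rw [subst_C, hC, Polynomial.coeff_C]
    split_ifs with hk
    · rw [hk, pow_zero, C_1, one_mul, subst_C]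
    · rw [map_zero, mul_zero]
  | add f g hf hg => simp only [map_add, Polynomial.coeff_add, hf, hg, mul_add]
  | mul_X f i hf =>
    refine Fin.cases ?_ (fun j => ?_) i
    · have : subst σ (X 0) = C (σ 0 0) * X 0 := by
        rw [subst_X, Fin.sum_univ_succ, Finset.sum_eq_zero, add_zero]
        intro i _
        rw [h1, C_0, zero_mul]
      rw [map_mul, this, map_mul, map_mul, map_mul, finSuccEquiv_X_zero, hC, ← mul_assoc]
      rcases k with _ | k
      · rw [Polynomial.coeff_mul_X_zero, Polynomial.coeff_mul_X_zero, map_zero, mul_zero]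
      · rw [Polynomial.coeff_mul_X, Polynomial.coeff_mul_X, Polynomial.coeff_mul_C, hf, pow_succ,
          C_mul]
        ring
    · have : finSuccEquiv K n (subst σ (X j.succ)) = Polynomial.C (subst τ (X j)) := by
        rw [subst_X, subst_X, Fin.sum_univ_succ, h0, C_0, zero_mul, zero_add, map_sum, map_sum]
        refine Finset.sum_congr rfl fun i _ => ?_
        rw [map_mul, hC, finSuccEquiv_X_succ, hτ, map_mul]
      rw [map_mul, map_mul, this, map_mul, finSuccEquiv_X_succ, Polynomial.coeff_mul_C,
        Polynomial.coeff_mul_C, hf, map_mul, mul_assoc]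

/-- The substitution `x_j ↦ x_j + T`. -/
def shift (j : Fin n) : MvPolynomial (Fin n) K →ₐ[K] Polynomial (MvPolynomial (Fin n) K) :=
  aeval fun i => if i = j then Polynomial.X + Polynomial.C (X i) else Polynomial.C (X i)

theorem coeff_shift_monomial (j : Fin n) (α : Fin n →₀ ℕ) (c : K) (e : ℕ) :
    (shift j (monomial α c)).coeff e =
      monomial (α - Finsupp.single j e) (c * ((α j).choose e : K)) := by
  have h1 : shift j (monomial α c) = Polynomial.C (C c) *
      ((Polynomial.X + Polynomial.C (X j)) ^ α j *
        Polynomial.C (∏ i ∈ Finset.univ.erase j, X i ^ α i)) := by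
    rw [shift, aeval_monomial, Finsupp.prod_fintype _ _ (by simp),
      ← Finset.mul_prod_erase _ _ (Finset.mem_univ j), if_pos rfl, map_prod,
      Finset.prod_congr rfl fun i hi => by rw [if_neg (Finset.ne_of_mem_erase hi), ← map_pow]]
    rfl
  have h2 : (monomial (α - Finsupp.single j e) (c * ((α j).choose e : K))) =
      C c * (((α j).choose e : MvPolynomial (Fin n) K) * (X j ^ (α j - e) *
        ∏ i ∈ Finset.univ.erase j, X i ^ α i)) := by
    rw [monomial_eq, Finsupp.prod_fintype _ _ (by simp),
      ← Finset.mul_prod_erase _ _ (Finset.mem_univ j), C_mul, map_natCast, mul_assoc,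
      Finset.prod_congr rfl fun i hi => by
        rw [Finsupp.tsub_apply, Finsupp.single_eq_of_ne (Finset.ne_of_mem_erase hi), Nat.sub_zero],
      Finsupp.tsub_apply, Finsupp.single_eq_same]
  rw [h1, h2, Polynomial.coeff_C_mul, Polynomial.coeff_mul_C, Polynomial.coeff_X_add_C_pow]
  ring

/-- The coefficients of T^e are the divided (Hasse) derivatives in x_j, which carry binomial
coefficients. -/
theorem coeff_coeff_shift (j : Fin n) (f : MvPolynomial (Fin n) K) (e : ℕ) (β : Fin n →₀ ℕ) :
    coeff β ((shift j f).coeff e) =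
      ((β j + e).choose e : K) * coeff (β + Finsupp.single j e) f := by
  induction f using MvPolynomial.induction_on' with
  | add f g hf hg => rw [map_add, Polynomial.coeff_add, coeff_add, coeff_add, hf, hg, mul_add]
  | monomial α c =>
    rw [coeff_shift_monomial, coeff_monomial, coeff_monomial]
    by_cases he : e ≤ α j
    · have hle : Finsupp.single j e ≤ α := by simpa using he
      by_cases h : α = β + Finsupp.single j e
      · subst h
        simp [mul_comm]
      · rw [if_neg h, if_neg, mul_zero]
        rintro rfl
        exact h (tsub_add_cancel_of_le hle).symm
    · rw [Nat.choose_eq_zero_of_lt (not_le.1 he), Nat.cast_zero, mul_zero, ite_self, if_neg,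
        mul_zero]
      rintro rfl
      simp at he

/-- For polynomials in x_0 the transvection x_j ↦ x_j + x_0 fixes the variable and shifts the
coefficients, with x_0 in the role of T. -/
theorem finSuccEquiv_subst_shift (σ : Matrix (Fin (n + 1)) (Fin (n + 1)) K) (j : Fin n)
    (h00 : σ 0 0 = 1) (h0 : ∀ i : Fin n, σ 0 i.succ = if i = j then 1 else 0)
    (h1 : ∀ i : Fin n, σ i.succ 0 = 0) (hτ : ∀ i k : Fin n, σ i.succ k.succ = if i = k then 1 else 0)
    (f : MvPolynomial (Fin (n + 1)) K) :
    finSuccEquiv K n (subst σ f) =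
      Polynomial.eval₂RingHom (shift (K := K) j : MvPolynomial (Fin n) K →+* _) Polynomial.X
        (finSuccEquiv K n f) := by
  have hC (a : K) : finSuccEquiv K n (C a) = Polynomial.C (C a) :=
    (finSuccEquiv K n).commutes a
  have hX (i : Fin (n + 1)) : finSuccEquiv K n (subst σ (X i)) =
      Polynomial.eval₂RingHom (shift (K := K) j : MvPolynomial (Fin n) K →+* _) Polynomial.X
        (finSuccEquiv K n (X i)) := by
    refine Fin.cases ?_ (fun i => ?_) i
    · rw [subst_X, Fin.sum_univ_succ, Finset.sum_eq_zero, add_zero, h00, C_1, one_mul,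
        finSuccEquiv_X_zero, Polynomial.coe_eval₂RingHom, Polynomial.eval₂_X]
      intro i _
      rw [h1, C_0, zero_mul]
    · rw [subst_X, Fin.sum_univ_succ, h0, finSuccEquiv_X_succ, Polynomial.coe_eval₂RingHom,
        Polynomial.eval₂_C, Finset.sum_eq_single i]
      · rw [hτ, if_pos rfl, C_1, one_mul, map_add, map_mul, finSuccEquiv_X_succ,
          finSuccEquiv_X_zero, hC]
        simp only [shift, RingHom.coe_coe, aeval_X]
        split_ifs <;> simp
      · intro b _ hb
        rw [hτ, if_neg hb, C_0, zero_mul]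
      · simp
  induction f using MvPolynomial.induction_on with
  | C a =>
    rw [subst_C, hC, Polynomial.coe_eval₂RingHom, Polynomial.eval₂_C]
    exact ((shift j).commutes a).symm
  | add f g hf hg => simp only [map_add, hf, hg]
  | mul_X f i hf => rw [map_mul, map_mul, map_mul, map_mul, hf, hX]

end Subst

/-! ## Leading coefficients of reduced invariants -/

section Leading

variable {F K : Type*} [Field F] [Field K] [Algebra F K] {n : ℕ}

theorem cons_lt {Q k : ℕ} {α : Fin n →₀ ℕ} (hk : k < Q) (hα : ∀ i, α i < Q) (i : Fin (n + 1)) :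
    α.cons k i < Q := by
  refine Fin.cases ?_ (fun i => ?_) i
  · simpa using hk
  · simpa using hα i

/-- The block diagonal matrix with blocks `a` and `τ`. -/
def blockCons (a : F) (τ : Matrix (Fin n) (Fin n) F) : Matrix (Fin (n + 1)) (Fin (n + 1)) F :=
  Fin.cons (Fin.cons a 0) fun i => Fin.cons 0 (τ i)

theorem isUpper_one : IsUpper (1 : Matrix (Fin n) (Fin n) F) :=
  ⟨fun i j h => Matrix.one_apply_ne h.ne', fun i => by simp⟩

theorem IsUpper.blockCons {a : F} (ha : a ≠ 0) {τ : Matrix (Fin n) (Fin n) F} (hτ : IsUpper τ) :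
    IsUpper (blockCons a τ) := by
  refine ⟨fun i j => ?_, fun i => ?_⟩
  · refine Fin.cases (fun h => absurd h (Fin.not_lt_zero _)) (fun i => ?_) i
    refine Fin.cases (fun _ => rfl) (fun j h => ?_) j
    exact hτ.1 i j (Fin.succ_lt_succ_iff.1 h)
  · refine Fin.cases ?_ (fun i => ?_) i
    · exact ha
    · exact hτ.2 i

theorem redInv.coeff_subst_coeff {Q d : ℕ} {f : MvPolynomial (Fin (n + 1)) K}
    (hf : f ∈ redInv F K Q (n + 1) d) {a : F} (ha : a ≠ 0) {τ : Matrix (Fin n) (Fin n) F}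
    (hτ : IsUpper τ) {k : ℕ} (hk : k < Q) {α : Fin n →₀ ℕ} (hα : ∀ i, α i < Q) :
    algebraMap F K a ^ k *
      coeff α (subst (τ.map (algebraMap F K)) ((finSuccEquiv K n f).coeff k)) =
        coeff α ((finSuccEquiv K n f).coeff k) := by
  have h := hf.2.2 _ (hτ.blockCons ha) _ (cons_lt hk hα)
  rw [← finSuccEquiv_coeff_coeff, ← finSuccEquiv_coeff_coeff, coeff_finSuccEquiv_subst _
    (τ.map (algebraMap F K)), coeff_C_mul] at h
  · exact h
  · exact fun j => map_zero (algebraMap F K)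
  · exact fun j => map_zero (algebraMap F K)
  · exact fun i j => rfl

theorem redInv.finSuccEquiv_coeff_mem {Q d : ℕ} {f : MvPolynomial (Fin (n + 1)) K}
    (hf : f ∈ redInv F K Q (n + 1) d) {k : ℕ} (hk : k < Q) (hkd : k ≤ d) :
    (finSuccEquiv K n f).coeff k ∈ redInv F K Q n (d - k) := by
  refine ⟨fun α h i => ?_, ?_, fun τ hτ α hα => ?_⟩
  · rw [finSuccEquiv_coeff_coeff] at h
    simpa using hf.1 _ h i.succ
  · exact hf.2.1.finSuccEquiv_coeff_isHomogeneous k (d - k) (by omega)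
  · have := redInv.coeff_subst_coeff hf one_ne_zero hτ hk hα
    rwa [map_one, one_pow, one_mul] at this

theorem redInv.finSuccEquiv_coeff_eq_zero {Q d : ℕ} {f : MvPolynomial (Fin (n + 1)) K}
    (hf : f ∈ redInv F K Q (n + 1) d) {k : ℕ} (hk : Q ≤ k ∨ d < k) :
    (finSuccEquiv K n f).coeff k = 0 := by
  ext α
  rw [finSuccEquiv_coeff_coeff, coeff_zero]
  by_contra h
  rcases hk with hk | hk
  · have := hf.1 _ h 0
    rw [Finsupp.cons_zero] at this
    omega
  · have h2 := hf.2.1 h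
    change Finsupp.weight (fun _ => 1) _ = d at h2
    rw [← Finsupp.degree_eq_weight_one, Finsupp.degree_eq_sum, Fin.sum_univ_succ,
      Finsupp.cons_zero] at h2
    omega

/-- The transvection `x_j ↦ x_j + x_0`. -/
def transv (F : Type*) [Field F] (j : Fin n) : Matrix (Fin (n + 1)) (Fin (n + 1)) F :=
  1 + Matrix.single 0 j.succ 1

theorem isUpper_transv (j : Fin n) : IsUpper (transv F j) := by
  refine ⟨fun i k h => ?_, fun i => ?_⟩
  · rw [transv, Matrix.add_apply, Matrix.one_apply_ne h.ne', Matrix.single_apply_of_row_ne, add_zero]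
    rintro rfl
    exact absurd h (Fin.not_lt_zero _)
  · rw [transv, Matrix.add_apply, Matrix.one_apply_eq, Matrix.single_apply, if_neg, add_zero]
    · exact one_ne_zero
    · rintro ⟨rfl, h⟩
      exact absurd h (Fin.succ_ne_zero j)

variable [Fintype F]

/-- The matrix diag(x, 1, …, 1) multiplies this coefficient by x^k, so x^k = 1 for all x in F^×. -/
theorem redInv.sub_one_dvd {Q d : ℕ} {f : MvPolynomial (Fin (n + 1)) K}
    (hf : f ∈ redInv F K Q (n + 1) d) {k : ℕ} (hk : k < Q)
    (hne : (finSuccEquiv K n f).coeff k ≠ 0) : Fintype.card F - 1 ∣ k := by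
  rw [← FiniteField.forall_pow_eq_one_iff F k]
  obtain ⟨α, hα⟩ := ne_zero_iff.1 hne
  have hlt : ∀ i, α i < Q := fun i => by
    rw [finSuccEquiv_coeff_coeff] at hα
    simpa using hf.1 _ hα i.succ
  intro x
  have h := redInv.coeff_subst_coeff hf x.ne_zero isUpper_one hk hlt
  rw [Matrix.map_one _ (map_zero _) (map_one _), subst_one, AlgHom.id_apply] at h
  have h2 := mul_right_cancel₀ hα (h.trans (one_mul _).symm)
  refine Units.ext (FaithfulSMul.algebraMap_injective F K ?_)
  simpa using h2

/-- A case of Lucas: (1+X)^N = (1+X^q)^{N/q} (1+X)^{N mod q}, whose coefficient at X^{N mod q} is 1.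
-/
theorem choose_mod_card_ne_zero (N : ℕ) : ((N.choose (N % Fintype.card F) : ℕ) : K) ≠ 0 := by
  obtain ⟨p, hp⟩ := CharP.exists F
  obtain ⟨r, hprime, hr⟩ := FiniteField.card F p
  have : Fact p.Prime := ⟨hprime⟩
  have : CharP K p := charP_of_injective_algebraMap (FaithfulSMul.algebraMap_injective F K) p
  set q := Fintype.card F with hq
  have hq0 : 0 < q := Fintype.card_pos
  have h1 : ((1 + Polynomial.X : Polynomial K) ^ N).coeff (N % q) = 1 := by
    conv_lhs => rw [← Nat.div_add_mod N q, pow_add, pow_mul, hr, add_pow_char_pow, one_pow, ← hr]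
    have : ((1 + (Polynomial.X : Polynomial K) ^ q) ^ (N / q)) =
        1 + Polynomial.X ^ q * ∑ i ∈ Finset.range (N / q),
          (1 + (Polynomial.X : Polynomial K) ^ q) ^ i := by
      have := geom_sum_mul (1 + (Polynomial.X : Polynomial K) ^ q) (N / q)
      rw [add_sub_cancel_left] at this
      rw [mul_comm, this]
      ring
    have hlt : N % q < q := Nat.mod_lt _ hq0
    rw [this, add_mul, one_mul, mul_assoc, Polynomial.coeff_add, Polynomial.coeff_X_pow_mul',
      if_neg (by rw [Nat.mul_add_mod, Nat.mod_mod]; omega), add_zero,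
      Polynomial.coeff_one_add_X_pow]
    simp
  rw [Polynomial.coeff_one_add_X_pow] at h1
  rw [h1]
  exact one_ne_zero

/-- If q did not divide α_j, then e = α_j mod q would lie strictly between 0 and q. Under x_j ↦ x_j
+ x_0 the coefficient of x_0^{a+e} would change by the e-th Hasse derivative of the leading
coefficient, which is nonzero because the binomial of α_j over e is. The hypothesis on a keeps
x_0^{a+e} below the truncation. -/
theorem redInv.card_dvd {Q d : ℕ} {f : MvPolynomial (Fin (n + 1)) K}
    (hf : f ∈ redInv F K Q (n + 1) d) {a : ℕ} (ha : a + (Fintype.card F - 1) < Q)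
    (hlow : ∀ b < a, (finSuccEquiv K n f).coeff b = 0) {α : Fin n →₀ ℕ}
    (hα : coeff α ((finSuccEquiv K n f).coeff a) ≠ 0) (j : Fin n) : Fintype.card F ∣ α j := by
  set q := Fintype.card F with hq
  have hq2 : 2 ≤ q := Fintype.one_lt_card
  set p := finSuccEquiv K n f with hp
  set g := p.coeff a with hg
  have hdvd_a : q - 1 ∣ a := redInv.sub_one_dvd hf (by omega) (ne_zero_iff.2 ⟨α, hα⟩)
  -- Exponents of x_0 that occur are multiples of q - 1, so none lies strictly between a and a + q -
  -- 1.
  obtain ⟨r, hr⟩ : Polynomial.X ^ (a + (q - 1)) ∣ p - Polynomial.X ^ a * Polynomial.C g := by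
    rw [Polynomial.X_pow_dvd_iff]
    intro k hk
    rw [Polynomial.coeff_sub, Polynomial.coeff_X_pow_mul', Polynomial.coeff_C]
    rcases lt_trichotomy k a with h | rfl | h
    · rw [hlow k h, if_neg (by omega), sub_zero]
    · simp [hg]
    · rw [if_pos h.le, if_neg (by omega), sub_zero]
      by_contra hne
      have h1 := redInv.sub_one_dvd hf (by omega) hne
      have h2 := Nat.le_of_dvd (by omega) ((Nat.dvd_sub h1 hdvd_a))
      omega
  by_contra hj
  set e := α j % q with he
  have he0 : 0 < e := Nat.pos_of_ne_zero fun h => hj (Nat.dvd_of_mod_eq_zero h)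
  have heq : e < q := Nat.mod_lt _ (by omega)
  have hej : e ≤ α j := Nat.mod_le _ _
  have hlt : ∀ i, α i < Q := fun i => by
    rw [hg, finSuccEquiv_coeff_coeff] at hα
    simpa using hf.1 _ hα i.succ
  set β := α - Finsupp.single j e with hβ
  have hβα : β + Finsupp.single j e = α := tsub_add_cancel_of_le (by simpa using hej)
  have hβlt : ∀ i, β i < Q := fun i => lt_of_le_of_lt (by simp [hβ]) (hlt i)
  have hinv := hf.2.2 _ (isUpper_transv j) _ (cons_lt (k := a + e) (by omega) hβlt)
  rw [← finSuccEquiv_coeff_coeff, ← finSuccEquiv_coeff_coeff, finSuccEquiv_subst_shift _ j] at hinv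
  · set Ψ := Polynomial.eval₂RingHom (shift (K := K) j : MvPolynomial (Fin n) K →+* Polynomial (MvPolynomial (Fin n) K))
      Polynomial.X with hΨ
    have hp' : p = Polynomial.X ^ a * Polynomial.C g + Polynomial.X ^ (a + (q - 1)) * r := by
      rw [← hr]; ring
    have hΨX : Ψ Polynomial.X = Polynomial.X := by
      rw [hΨ, Polynomial.coe_eval₂RingHom, Polynomial.eval₂_X]
    have hΨC : Ψ (Polynomial.C g) = shift j g := by
      rw [hΨ, Polynomial.coe_eval₂RingHom, Polynomial.eval₂_C, RingHom.coe_coe]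
    have hdiff : Ψ p - p = Polynomial.X ^ a * (shift j g - Polynomial.C g) +
        Polynomial.X ^ (a + (q - 1)) * (Ψ r - r) := by
      rw [hp']
      simp only [map_add, map_mul, map_pow, hΨX, hΨC]
      ring
    -- Setting x_0 = 0 undoes the transvection. This removes the contribution of r in the boundary
    -- case e = q - 1.
    have h0 (s : Polynomial (MvPolynomial (Fin n) K)) : (Ψ s - s).coeff 0 = 0 := by
      have : Polynomial.constantCoeff.comp Ψ = Polynomial.constantCoeff := by
        refine Polynomial.ringHom_ext' (MvPolynomial.ringHom_ext ?_ ?_) ?_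
        · intro c
          simp [hΨ, shift]
        · intro i
          simp only [hΨ, shift, RingHom.comp_apply, Polynomial.coe_eval₂RingHom,
            Polynomial.eval₂_C, RingHom.coe_coe, aeval_X]
          split_ifs <;> simp
        · simp [hΨ]
      have := RingHom.congr_fun this s
      rw [RingHom.comp_apply, Polynomial.constantCoeff_apply, Polynomial.constantCoeff_apply] at this
      rw [Polynomial.coeff_sub, this, sub_self]
    have hz : (Ψ p - p).coeff (a + e) = (shift j g).coeff e := by
      rw [hdiff, Polynomial.coeff_add, Polynomial.coeff_X_pow_mul', if_pos (by omega),
        Polynomial.coeff_X_pow_mul', Nat.add_sub_cancel_left, Polynomial.coeff_sub,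
        Polynomial.coeff_C, if_neg he0.ne', sub_zero]
      split_ifs with h
      · rw [show a + e - (a + (q - 1)) = 0 by omega, h0, add_zero]
      · rw [add_zero]
    have hz2 : coeff β ((shift j g).coeff e) = 0 := by
      rw [← hz, Polynomial.coeff_sub, coeff_sub, hinv, sub_self]
    rw [coeff_coeff_shift, hβα, show β j + e = α j by simp [hβ, hej], he] at hz2
    exact (mul_ne_zero (choose_mod_card_ne_zero (F := F) (K := K) (α j)) hα) hz2
  all_goals simp [transv, Matrix.one_apply, Matrix.single_apply, Fin.succ_ne_zero, eq_comm]

/-- The q-th power is additive and fixes the matrix entries, which lie in F. -/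
theorem subst_expand (σ : Matrix (Fin n) (Fin n) F) (f : MvPolynomial (Fin n) K) :
    subst (σ.map (algebraMap F K)) (expand (Fintype.card F) f) =
      expand (Fintype.card F) (subst (σ.map (algebraMap F K)) f) := by
  obtain ⟨p, hp⟩ := CharP.exists F
  obtain ⟨r, hprime, hr⟩ := FiniteField.card F p
  have : Fact p.Prime := ⟨hprime⟩
  have : CharP K p := charP_of_injective_algebraMap (FaithfulSMul.algebraMap_injective F K) p
  have : ExpChar (MvPolynomial (Fin n) K) p := ExpChar.prime hprime
  rw [← AlgHom.comp_apply, ← AlgHom.comp_apply]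
  congr 1
  ext1 j
  rw [AlgHom.comp_apply, AlgHom.comp_apply, expand_X, map_pow, subst_X, map_sum, hr,
    sum_pow_char_pow]
  refine Finset.sum_congr rfl fun i _ => ?_
  rw [mul_pow, map_mul, expand_X, expand_C, ← hr, ← C_pow, Matrix.map_apply, ← map_pow,
    FiniteField.pow_card]

/-- Reduced invariants in `x_1^q, …, x_n^q` come from reduced invariants. -/
theorem redInv.exists_expand_eq {m d : ℕ} {g : MvPolynomial (Fin n) K}
    (hg : g ∈ redInv F K (Fintype.card F ^ (m + 1)) n d)
    (hdvd : ∀ α, coeff α g ≠ 0 → ∀ j, Fintype.card F ∣ α j) :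
    ∃ G ∈ redInv F K (Fintype.card F ^ m) n (d / Fintype.card F),
      expand (Fintype.card F) G = g := by
  set q := Fintype.card F with hq
  have hq0 : q ≠ 0 := Fintype.card_ne_zero
  let G : MvPolynomial (Fin n) K :=
    ∑ α ∈ g.support, monomial (α.mapRange (· / q) (Nat.zero_div q)) (coeff α g)
  have hG : expand q G = g := by
    conv_rhs => rw [← support_sum_monomial_coeff g]
    rw [map_sum]
    refine Finset.sum_congr rfl fun α hα => ?_
    have : q • α.mapRange (· / q) (Nat.zero_div q) = α := by
      ext i
      simpa using Nat.mul_div_cancel' (hdvd α (mem_support_iff.1 hα) i)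
    rw [expand_monomial, this]
  have hcoeff (α : Fin n →₀ ℕ) : coeff α G = coeff (q • α) g := by
    rw [← hG, coeff_expand_smul q hq0]
  refine ⟨G, ⟨fun α h i => ?_, fun α h => ?_, fun σ hσ α hα => ?_⟩, hG⟩
  · rw [hcoeff] at h
    have := hg.1 _ h i
    rw [Finsupp.smul_apply, smul_eq_mul, pow_succ, mul_comm] at this
    exact lt_of_mul_lt_mul_right this (Nat.zero_le q)
  · rw [hcoeff] at h
    have := hg.2.1 h
    rw [map_nsmul, smul_eq_mul] at this
    rw [← this, Nat.mul_div_cancel_left _ (Nat.pos_of_ne_zero hq0)]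
  · rw [← coeff_expand_smul q hq0, ← subst_expand, hG, hcoeff]
    refine hg.2.2 σ hσ _ fun i => ?_
    rw [Finsupp.smul_apply, smul_eq_mul, pow_succ, mul_comm]
    exact Nat.mul_lt_mul_of_pos_right (hα i) (Nat.pos_of_ne_zero hq0)

end Leading

/-! ## The upper bound for the dimensions -/

theorem sum_range_mul_of_dvd {M : Type*} [AddCommMonoid M] {r : ℕ} (hr : 0 < r) (N : ℕ)
    (T : ℕ → M) (hT : ∀ a, ¬ r ∣ a → T a = 0) :
    ∑ a ∈ Finset.range (r * N), T a = ∑ k ∈ Finset.range N, T (r * k) := by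
  have hinj : Function.Injective (r * ·) := fun a b h => Nat.eq_of_mul_eq_mul_left hr h
  rw [← Finset.sum_image (g := (r * ·)) (f := T) (fun a _ b _ h => hinj h), eq_comm]
  refine Finset.sum_subset ?_ ?_
  · intro a ha
    obtain ⟨k, hk, rfl⟩ := Finset.mem_image.1 ha
    exact Finset.mem_range.2 (Nat.mul_lt_mul_of_pos_left (Finset.mem_range.1 hk) hr)
  · intro a ha ha'
    refine hT a ?_
    rintro ⟨k, rfl⟩
    exact ha' (Finset.mem_image_of_mem _ (Finset.mem_range.2
      (lt_of_mul_lt_mul_left (Finset.mem_range.1 ha) (Nat.zero_le r))))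

theorem finrank_redInv_le (F K : Type*) [Field F] [Fintype F] [Field K] [Algebra F K] (n m d : ℕ) :
    Module.finrank K (redInv F K (Fintype.card F ^ m) n d) ≤
      (borelPoly (Fintype.card F) n m).coeff d := by
  set q := Fintype.card F with hq
  have hq2 : 2 ≤ q := Fintype.one_lt_card
  induction n generalizing m d with
  | zero =>
    rw [borelPoly, Polynomial.coeff_one]
    split_ifs with hd
    · have hle : redInv F K (q ^ m) 0 d ≤ Submodule.span K {1} := fun f _ => by
        rw [eq_C_of_isEmpty f, ← mul_one (C _), ← smul_eq_C_mul]
        exact Submodule.smul_mem _ _ (Submodule.mem_span_singleton_self _)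
      exact (Submodule.finrank_mono hle).trans (finrank_span_le_card ({1} : Set _) |>.trans (by simp))
    · have : redInv F K (q ^ m) 0 d = ⊥ := (Submodule.eq_bot_iff _).2 fun f hf => by
        ext α
        by_contra h
        have := hf.2.1 h
        rw [Subsingleton.elim α 0, map_zero] at this
        exact hd this.symm
      rw [this, finrank_bot]
  | succ n ih =>
    set Q := q ^ m with hQ
    have hQ1 : 1 ≤ Q := Nat.one_le_pow _ _ (by omega)
    let κ (a : ℕ) : MvPolynomial (Fin (n + 1)) K →ₗ[K] MvPolynomial (Fin n) K :=
      (Polynomial.lcoeff (MvPolynomial (Fin n) K) a).restrictScalars K ∘ₗ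
        (finSuccEquiv K n).toLinearMap
    have hκ (a f) : κ a f = (finSuccEquiv K n f).coeff a := rfl
    have hker : ∀ f ∈ redInv F K Q (n + 1) d, (∀ a < Q, κ a f = 0) → f = 0 := by
      intro f hf h
      refine (finSuccEquiv K n).injective ?_
      rw [map_zero]
      ext1 a
      rcases lt_or_ge a Q with ha | ha
      · exact h a ha
      · exact redInv.finSuccEquiv_coeff_eq_zero hf (Or.inl ha)
    cases m with
    | zero =>
      have hQ' : Q = 1 := pow_zero q
      rw [borelPoly]
      refine (finrank_le_sum_of_leading Q _ κ (fun _ => redInv F K Q n d)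
        (fun _ => inferInstance) hker ?_).trans ?_
      · intro a ha f hf _
        obtain rfl : a = 0 := by omega
        exact redInv.finSuccEquiv_coeff_mem hf ha (Nat.zero_le d)
      · rw [hQ', Finset.sum_range_one]
        exact ih 0 d
    | succ m =>
      let E : MvPolynomial (Fin n) K →ₗ[K] MvPolynomial (Fin n) K :=
        (expand q : MvPolynomial (Fin n) K →ₐ[K] _).toLinearMap
      -- The possible leading coefficients at x_0^a: arbitrary reduced invariants for the top
      -- exponent a = Q - 1, and otherwise only those coming from m by x ↦ x^q.
      let L (a : ℕ) : Submodule K (MvPolynomial (Fin n) K) :=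
        if a ≤ d then
          if a = Q - 1 then redInv F K Q n (d - a)
          else if q - 1 ∣ a ∧ q ∣ d - a then (redInv F K (q ^ m) n ((d - a) / q)).map E else ⊥
        else ⊥
      have e1 : Q - 1 ≤ d → L (Q - 1) = redInv F K Q n (d - (Q - 1)) := fun h =>
        (if_pos h).trans (if_pos rfl)
      have e2 (a : ℕ) (h1 : a ≤ d) (h2 : a ≠ Q - 1) (h3 : q - 1 ∣ a ∧ q ∣ d - a) :
          L a = (redInv F K (q ^ m) n ((d - a) / q)).map E :=
        (if_pos h1).trans ((if_neg h2).trans (if_pos h3))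
      have e3 (a : ℕ) (h1 : a ≤ d) (h2 : a ≠ Q - 1) (h3 : ¬(q - 1 ∣ a ∧ q ∣ d - a)) : L a = ⊥ :=
        (if_pos h1).trans ((if_neg h2).trans (if_neg h3))
      have e4 (a : ℕ) (h1 : ¬a ≤ d) : L a = ⊥ := if_neg h1
      clear_value L
      have hL (a : ℕ) : FiniteDimensional K (L a) := by
        by_cases h1 : a ≤ d
        · by_cases h2 : a = Q - 1
          · subst h2
            rw [e1 h1]
            infer_instance
          · by_cases h3 : q - 1 ∣ a ∧ q ∣ d - a
            · rw [e2 a h1 h2 h3]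
              infer_instance
            · rw [e3 a h1 h2 h3]
              infer_instance
        · rw [e4 a h1]
          infer_instance
      refine (finrank_le_sum_of_leading Q _ κ L hL hker ?_).trans ?_
      · intro a ha f hf hlow
        rw [hκ]
        by_cases h0 : (finSuccEquiv K n f).coeff a = 0
        · rw [h0]
          exact Submodule.zero_mem _
        have had : a ≤ d := le_of_not_gt fun h =>
          h0 (redInv.finSuccEquiv_coeff_eq_zero hf (Or.inr h))
        have hmem := redInv.finSuccEquiv_coeff_mem hf ha had
        have hdvd := redInv.sub_one_dvd hf ha h0
        by_cases h1 : a = Q - 1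
        · subst h1
          rw [e1 had]
          exact hmem
        -- Both a and Q - 1 are multiples of q - 1, and a < Q - 1.
        have hlt : a + (q - 1) < Q := by
          obtain ⟨k, hk⟩ := hdvd
          have h3 : Q - 1 = (q - 1) * lineCount q (m + 1) :=
            (sub_one_mul_lineCount (by omega) _).symm
          have h4 : k < lineCount q (m + 1) := by
            refine lt_of_mul_lt_mul_left (a := q - 1) ?_ (Nat.zero_le _)
            rw [← h3, ← hk]
            omega
          have h5 := Nat.mul_le_mul_left (q - 1) (Nat.succ_le_of_lt h4)
          rw [← h3, Nat.mul_succ, ← hk] at h5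
          omega
        have hexp := fun α hα j => redInv.card_dvd hf hlt hlow (α := α) hα j
        rw [e2 a had h1 ⟨hdvd, ?_⟩]
        · exact redInv.exists_expand_eq hmem hexp
        · obtain ⟨α, hα⟩ := ne_zero_iff.1 h0
          rw [← hmem.2.1 hα]
          change q ∣ Finsupp.weight (fun _ => 1) α
          rw [← Finsupp.degree_eq_weight_one, Finsupp.degree_eq_sum]
          exact Finset.dvd_sum fun j _ => hexp α hα j
      · have hbound (a : ℕ) (ha : a ≠ Q - 1) : Module.finrank K (L a) ≤
            if q - 1 ∣ a then if a ≤ d then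
              (Polynomial.expand ℕ q (borelPoly q n m)).coeff (d - a) else 0 else 0 := by
          by_cases h1 : a ≤ d
          · by_cases h3 : q - 1 ∣ a ∧ q ∣ d - a
            · rw [e2 a h1 ha h3, if_pos h3.1, if_pos h1, Polynomial.coeff_expand (by omega),
                if_pos h3.2]
              exact (Submodule.finrank_map_le _ _).trans (ih m _)
            · rw [e3 a h1 ha h3, finrank_bot]
              exact Nat.zero_le _
          · rw [e4 a h1, finrank_bot]
            exact Nat.zero_le _
        have hlast : Module.finrank K (L (Q - 1)) ≤
            if Q - 1 ≤ d then (borelPoly q n (m + 1)).coeff (d - (Q - 1)) else 0 := by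
          by_cases h1 : Q - 1 ≤ d
          · rw [e1 h1, if_pos h1]
            exact ih (m + 1) _
          · rw [e4 _ h1, finrank_bot]
            exact Nat.zero_le _
        have hQs : Finset.range Q = Finset.range (Q - 1 + 1) := by rw [Nat.sub_add_cancel hQ1]
        rw [hQs, Finset.sum_range_succ, borelPoly, Polynomial.coeff_add,
          Polynomial.coeff_X_pow_mul', add_comm]
        refine add_le_add hlast ((Finset.sum_le_sum fun a ha =>
          hbound a (Finset.mem_range.1 ha).ne).trans ?_)
        rw [hQ, ← sub_one_mul_lineCount (by omega), sum_range_mul_of_dvd (by omega), Finset.sum_mul,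
          Polynomial.finsetSum_coeff]
        · refine Finset.sum_le_sum fun k _ => ?_
          rw [if_pos (Nat.dvd_mul_right _ _), Polynomial.coeff_X_pow_mul']
        · intro a ha
          rw [if_neg ha]

/-! ## The lower bound for the total dimension -/

section Homogeneous

variable {K : Type*} [Field K] {n : ℕ}

theorem isHomogeneous_subst (σ : Matrix (Fin n) (Fin n) K) {d : ℕ} {f : MvPolynomial (Fin n) K}
    (hf : f.IsHomogeneous d) : (subst σ f).IsHomogeneous d := by
  have := hf.aeval (fun j => ∑ i, C (σ i j) * X i) (n := 1) fun j =>
    IsHomogeneous.sum _ _ _ fun i _ => by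
      simpa using (isHomogeneous_C (Fin n) (σ i j)).mul (isHomogeneous_X K i)
  rwa [one_mul] at this

theorem degree_eq_of_isHomogeneous {d : ℕ} {f : MvPolynomial (Fin n) K} (hf : f.IsHomogeneous d)
    {α : Fin n →₀ ℕ} (h : coeff α f ≠ 0) : α.degree = d := by
  rw [Finsupp.degree_eq_weight_one]
  exact hf h

theorem coeff_subst_homogeneousComponent (σ : Matrix (Fin n) (Fin n) K)
    (f : MvPolynomial (Fin n) K) (α : Fin n →₀ ℕ) (d : ℕ) :
    coeff α (subst σ (homogeneousComponent d f)) =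
      if α.degree = d then coeff α (subst σ f) else 0 := by
  have h0 (i : ℕ) (hi : α.degree ≠ i) : coeff α (subst σ (homogeneousComponent i f)) = 0 :=
    by_contra fun h => hi (degree_eq_of_isHomogeneous
      (isHomogeneous_subst σ (homogeneousComponent_isHomogeneous i f)) h)
  split_ifs with hd
  · conv_rhs => rw [← sum_homogeneousComponent f, map_sum, coeff_sum]
    rw [Finset.sum_eq_single d]
    · intro i _ hi
      exact h0 i (by omega)
    · intro h
      rw [homogeneousComponent_eq_zero _ _ (by simpa using h), map_zero, coeff_zero]
  · exact h0 d hd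

end Homogeneous

/-! ### Polynomials vanishing on all of K^n -/

section Field

variable {K : Type*} [Field K] [Fintype K] {n : ℕ}

theorem prod_X_sub_C_eq (i : Fin n) :
    (∏ r : K, (X i - C r) : MvPolynomial (Fin n) K) = X i ^ Fintype.card K - X i := by
  have hcard : 1 < Fintype.card K := Fintype.one_lt_card
  have hmonic : (Polynomial.X ^ Fintype.card K - Polynomial.X : Polynomial K).Monic :=
    (Polynomial.monic_X_pow _).sub_of_left (by
      rw [Polynomial.degree_X, Polynomial.degree_X_pow]
      exact_mod_cast hcard)
  have h := Polynomial.prod_multiset_X_sub_C_of_monic_of_roots_card_eq hmonic (by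
    rw [FiniteField.roots_X_pow_card_sub_X, FiniteField.X_pow_card_sub_X_natDegree_eq K hcard]
    rfl)
  rw [FiniteField.roots_X_pow_card_sub_X] at h
  have h2 := congrArg (Polynomial.aeval (X i : MvPolynomial (Fin n) K)) h
  rw [map_sub, map_pow, Polynomial.aeval_X] at h2
  rw [← h2]
  change _ = Polynomial.aeval (X i) (∏ r : K, (Polynomial.X - Polynomial.C r))
  rw [map_prod]
  refine Finset.prod_congr rfl fun r _ => ?_
  rw [map_sub, Polynomial.aeval_X, Polynomial.aeval_C]
  rfl

/-- A polynomial of degree `≤ d` that vanishes on `K^n` has no monomial of degree `d` with all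
exponents less than `|K|`. -/
theorem coeff_eq_zero_of_forall_eval_eq_zero {g : MvPolynomial (Fin n) K}
    (hg : ∀ v, eval v g = 0) {α : Fin n →₀ ℕ} (hα : ∀ i, α i < Fintype.card K)
    (hd : g.totalDegree ≤ α.degree) : coeff α g = 0 := by
  -- Write g = ∑ h_i (x_i^Q - x_i) with every summand of degree at most deg g, where Q = |K|. At α
  -- the part h_i x_i^Q is invisible, and a contribution of h_i x_i would force the summand to have
  -- degree at least |α| - 1 + Q > |α|.
  obtain ⟨h, h1, h2⟩ := combinatorial_nullstellensatz_exists_linearCombination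
    (fun _ : Fin n => (Finset.univ : Finset K)) (fun _ => Finset.univ_nonempty) g
    (fun v _ => hg v)
  have hQ : 2 ≤ Fintype.card K := Fintype.one_lt_card
  rw [h2, Finsupp.linearCombination_apply, Finsupp.sum_fintype _ _ (by simp), coeff_sum]
  refine Finset.sum_eq_zero fun i _ => ?_
  have h3 := (h1 i).trans hd
  rw [prod_X_sub_C_eq] at h3 ⊢
  rw [smul_eq_mul, mul_sub, coeff_sub, coeff_mul_X', X_pow_eq_monomial, coeff_mul_monomial',
    if_neg (by simpa using hα i), zero_sub, neg_eq_zero]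
  split_ifs with hi
  · by_contra hne
    have hne' : h i ≠ 0 := fun h0 => hne (by rw [h0, coeff_zero])
    have hP : coeff (Finsupp.single i (Fintype.card K))
        (X i ^ Fintype.card K - X i : MvPolynomial (Fin n) K) = 1 := by
      rw [coeff_sub, coeff_X_pow, if_pos rfl, coeff_X, if_neg, sub_zero]
      intro h
      have := DFunLike.congr_fun h i
      simp at this
      omega
    have hP0 : (X i ^ Fintype.card K - X i : MvPolynomial (Fin n) K) ≠ 0 := by
      intro h0
      rw [h0, coeff_zero] at hP
      exact zero_ne_one hP
    have h4 := le_totalDegree (mem_support_iff.2 (hP.trans_ne one_ne_zero))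
    have h5 := le_totalDegree (mem_support_iff.2 hne)
    rw [totalDegree_mul_of_isDomain hP0 hne'] at h3
    have h6 : (α - Finsupp.single i 1).degree + 1 = α.degree := by
      have hle : Finsupp.single i 1 ≤ α := by
        simpa [Nat.one_le_iff_ne_zero] using Finsupp.mem_support_iff.1 hi
      have := congrArg Finsupp.degree (tsub_add_cancel_of_le hle)
      rwa [map_add, Finsupp.degree_single] at this
    rw [Finsupp.sum_single_index rfl] at h4
    change (α - Finsupp.single i 1).degree ≤ _ at h5
    omega
  · rfl

end Field

theorem eval_subst {K : Type*} [Field K] {n : ℕ} (σ : Matrix (Fin n) (Fin n) K)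
    (f : MvPolynomial (Fin n) K) (v : Fin n → K) :
    eval v (subst σ f) = eval (fun j => ∑ i, σ i j * v i) f := by
  induction f using MvPolynomial.induction_on with
  | C a => rw [subst_C, eval_C, eval_C]
  | add f g hf hg => simp [hf, hg]
  | mul_X f i hf => simp [hf, subst_X]

/-! ### Invariant functions on K^n -/

section Total

variable (F K : Type*) [Field F] [Field K] [Algebra F K] [Fintype K] (n : ℕ)

/-- The polynomials with all exponents less than `|K|` whose functions on `K^n` are invariant under
the upper triangular matrices over `F`. -/
def invariantFunctions : Submodule K (MvPolynomial (Fin n) K) where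
  carrier := {f | f ∈ restrictDegree (Fin n) K (Fintype.card K - 1) ∧
    ∀ σ : Matrix (Fin n) (Fin n) F, IsUpper σ → ∀ v : Fin n → K,
      eval (fun j => ∑ i, σ i j • v i) f = eval v f}
  zero_mem' := ⟨Submodule.zero_mem _, by simp⟩
  add_mem' := by
    rintro f g ⟨f1, f2⟩ ⟨g1, g2⟩
    exact ⟨Submodule.add_mem _ f1 g1, fun σ hσ v => by rw [map_add, map_add, f2 σ hσ, g2 σ hσ]⟩
  smul_mem' := by
    rintro c f ⟨f1, f2⟩
    exact ⟨Submodule.smul_mem _ c f1, fun σ hσ v => by rw [smul_eval, smul_eval, f2 σ hσ]⟩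

variable {F K n}

theorem lt_card_of_mem_invariantFunctions {f : MvPolynomial (Fin n) K}
    (hf : f ∈ invariantFunctions F K n) {α : Fin n →₀ ℕ} (h : coeff α f ≠ 0) (i : Fin n) :
    α i < Fintype.card K := by
  have h1 := (mem_restrictDegree (Fin n) f _).1 hf.1 α (mem_support_iff.2 h) i
  have h2 : 0 < Fintype.card K := Fintype.card_pos
  omega

theorem degree_le_of_mem_invariantFunctions {f : MvPolynomial (Fin n) K}
    (hf : f ∈ invariantFunctions F K n) {α : Fin n →₀ ℕ} (h : coeff α f ≠ 0) :
    α.degree ≤ n * Fintype.card K := by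
  rw [Finsupp.degree_eq_sum]
  refine (Finset.sum_le_sum fun i _ => (lt_card_of_mem_invariantFunctions hf h i).le).trans ?_
  simp

instance : FiniteDimensional K (invariantFunctions F K n) := by
  have : FiniteDimensional K (restrictTotalDegree (Fin n) K (n * Fintype.card K)) :=
    inferInstance
  have hle : invariantFunctions F K n ≤ restrictTotalDegree (Fin n) K (n * Fintype.card K) := by
    intro f hf
    rw [mem_restrictTotalDegree]
    exact Finset.sup_le fun α hα =>
      degree_le_of_mem_invariantFunctions hf (mem_support_iff.1 hα)
  exact Submodule.finiteDimensional_of_le hle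

/-- The top component of an invariant function is a reduced invariant. -/
theorem homogeneousComponent_mem_redInv {f : MvPolynomial (Fin n) K}
    (hf : f ∈ invariantFunctions F K n) {d : ℕ} (hd : f.totalDegree ≤ d) :
    homogeneousComponent d f ∈ redInv F K (Fintype.card K) n d := by
  refine ⟨fun α h => ?_, homogeneousComponent_isHomogeneous d f, fun σ hσ α hα => ?_⟩
  · rw [coeff_homogeneousComponent] at h
    exact lt_card_of_mem_invariantFunctions hf fun h0 => h (by rw [h0, ite_self])
  · rw [coeff_subst_homogeneousComponent, coeff_homogeneousComponent]
    split_ifs with h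
    -- The difference of the two sides vanishes as a function on K^n and has degree at most d, so
    -- its reduced part of degree d is zero.
    · rw [← sub_eq_zero, ← coeff_sub]
      refine coeff_eq_zero_of_forall_eval_eq_zero (fun v => ?_) hα ?_
      · rw [map_sub, eval_subst, sub_eq_zero, ← hf.2 σ hσ v]
        simp only [Matrix.map_apply, Algebra.smul_def]
      · rw [h]
        refine (totalDegree_sub _ _).trans (max_le ?_ hd)
        refine Finset.sup_le fun β hβ => ?_
        by_contra hlt
        change ¬ β.degree ≤ d at hlt
        have h1 := coeff_subst_homogeneousComponent (σ.map (algebraMap F K)) f β β.degree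
        rw [if_pos rfl, homogeneousComponent_eq_zero _ _ (lt_of_le_of_lt hd (not_le.1 hlt)),
          map_zero, coeff_zero] at h1
        exact mem_support_iff.1 hβ h1.symm
    · rfl

theorem finrank_invariantFunctions_le {D : ℕ} (hD : n * Fintype.card K ≤ D) :
    Module.finrank K (invariantFunctions F K n) ≤
      ∑ d ∈ Finset.range (D + 1), Module.finrank K (redInv F K (Fintype.card K) n d) := by
  -- The leading component is the one of highest degree, so index a stands for degree D - a.
  rw [← Finset.sum_range_reflect]
  refine finrank_le_sum_of_leading (D + 1) _ (fun a => homogeneousComponent (D + 1 - 1 - a)) _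
    (fun _ => inferInstance) (fun f hf h => ?_) (fun a ha f hf h => ?_)
  · ext α
    by_contra hne
    have h1 := (degree_le_of_mem_invariantFunctions hf hne).trans hD
    have h2 := congrArg (coeff α) (h (D - α.degree) (by omega))
    rw [coeff_homogeneousComponent, if_pos (by omega), coeff_zero] at h2
    exact hne h2
  · refine homogeneousComponent_mem_redInv hf (Finset.sup_le fun α hα => ?_)
    by_contra hlt
    change ¬ α.degree ≤ _ at hlt
    have hne := mem_support_iff.1 hα
    have h1 := (degree_le_of_mem_invariantFunctions hf hne).trans hD
    have h2 := congrArg (coeff α) (h (D - α.degree) (by omega))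
    rw [coeff_homogeneousComponent, if_pos (by omega), coeff_zero] at h2
    exact hne h2

/-- Functions on Z pull back injectively along θ to invariant functions, and every function on K^n
is given by a reduced polynomial. -/
theorem card_le_finrank_invariantFunctions {Z : Type*} [Finite Z] (θ : (Fin n → K) → Z)
    (hs : Function.Surjective θ) (hθ : ∀ σ : Matrix (Fin n) (Fin n) F, IsUpper σ →
      ∀ v, θ (fun j => ∑ i, σ i j • v i) = θ v) :
    Nat.card Z ≤ Module.finrank K (invariantFunctions F K n) := by
  have := Fintype.ofFinite Z
  have h1 : LinearMap.range (LinearMap.funLeft K K θ) ≤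
      (invariantFunctions F K n).map (evalₗ K (Fin n)) := by
    rintro _ ⟨φ, rfl⟩
    have h2 : LinearMap.funLeft K K θ φ ∈
        (restrictDegree (Fin n) K (Fintype.card K - 1)).map (evalₗ K (Fin n)) := by
      rw [map_restrict_dom_evalₗ]
      exact Submodule.mem_top
    obtain ⟨f, hf, hfφ⟩ := h2
    refine ⟨f, ⟨hf, fun σ hσ v => ?_⟩, hfφ⟩
    have h3 := congrFun hfφ (fun j => ∑ i, σ i j • v i)
    have h4 := congrFun hfφ v
    rw [evalₗ_apply, LinearMap.funLeft_apply] at h3 h4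
    rw [h3, h4, hθ σ hσ]
  calc Nat.card Z = Module.finrank K (Z → K) := by
        rw [Module.finrank_fintype_fun_eq_card, Nat.card_eq_fintype_card]
    _ = Module.finrank K (LinearMap.range (LinearMap.funLeft K K θ)) :=
        (LinearMap.finrank_range_of_inj (LinearMap.funLeft_injective_of_surjective K K θ hs)).symm
    _ ≤ _ := Submodule.finrank_mono h1
    _ ≤ _ := Submodule.finrank_map_le _ _

/-- The total dimension of the reduced invariants over a field with `q^m` elements. -/
theorem eval_one_borelPoly_le_sum [Fintype F] {m D : ℕ} (hm : Module.finrank F K = m)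
    (hD : n * Fintype.card K ≤ D) : (borelPoly (Fintype.card F) n m).eval 1 ≤
      ∑ d ∈ Finset.range (D + 1), Module.finrank K (redInv F K (Fintype.card K) n d) := by
  obtain ⟨Z, hZ, θ, hc, hs, hθ⟩ := exists_orbit_invariant (F := F) n m K hm
  rw [← hc]
  exact (card_le_finrank_invariantFunctions θ hs fun σ hσ => hθ σ hσ.1 hσ.2).trans
    (finrank_invariantFunctions_le hD)

end Total

/-! ### Descent from K to F -/

section BaseChange

variable {F K : Type*} [Field F] [Field K] [Algebra F K] {n : ℕ}

/-- Apply a linear form to all coefficients. -/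
def mapCoeff (l : K →ₗ[F] F) (f : MvPolynomial (Fin n) K) : MvPolynomial (Fin n) F :=
  ∑ α ∈ f.support, monomial α (l (coeff α f))

theorem coeff_mapCoeff (l : K →ₗ[F] F) (f : MvPolynomial (Fin n) K) (α : Fin n →₀ ℕ) :
    coeff α (mapCoeff l f) = l (coeff α f) := by
  rw [mapCoeff, coeff_sum]
  simp only [coeff_monomial, Finset.sum_ite_eq']
  split_ifs with h
  · rfl
  · rw [notMem_support_iff.1 h, map_zero]

theorem subst_map (σ : Matrix (Fin n) (Fin n) F) (f : MvPolynomial (Fin n) F) :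
    subst (σ.map (algebraMap F K)) (map (algebraMap F K) f) =
      map (algebraMap F K) (subst σ f) := by
  induction f using MvPolynomial.induction_on with
  | C a => rw [map_C, subst_C, subst_C, map_C]
  | add f g hf hg => simp only [map_add, hf, hg]
  | mul_X f i hf => simp only [map_mul, hf, map_X, subst_X, map_sum, map_C, Matrix.map_apply]

theorem coeff_subst_mapCoeff (l : K →ₗ[F] F) (σ : Matrix (Fin n) (Fin n) F)
    (f : MvPolynomial (Fin n) K) (α : Fin n →₀ ℕ) :
    coeff α (subst σ (mapCoeff l f)) = l (coeff α (subst (σ.map (algebraMap F K)) f)) := by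
  conv_rhs => rw [← support_sum_monomial_coeff f]
  rw [mapCoeff, map_sum, map_sum, coeff_sum, coeff_sum, map_sum]
  refine Finset.sum_congr rfl fun β _ => ?_
  have h1 (c : K) : monomial β c = C c * map (algebraMap F K) (monomial β 1) := by
    rw [map_monomial, map_one, C_mul_monomial, mul_one]
  have h2 (c : F) : monomial β c = C c * monomial β 1 := by rw [C_mul_monomial, mul_one]
  rw [h1, h2, map_mul, map_mul, subst_C, subst_C, subst_map, coeff_C_mul, coeff_C_mul, coeff_map,
    mul_comm (coeff β f), ← Algebra.smul_def, map_smul, smul_eq_mul, mul_comm]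

theorem mapCoeff_mem_redInv (l : K →ₗ[F] F) {Q d : ℕ} {f : MvPolynomial (Fin n) K}
    (hf : f ∈ redInv F K Q n d) : mapCoeff l f ∈ redInv F F Q n d := by
  have h0 {α : Fin n →₀ ℕ} (h : coeff α (mapCoeff l f) ≠ 0) : coeff α f ≠ 0 := fun h' =>
    h (by rw [coeff_mapCoeff, h', map_zero])
  refine ⟨fun α h => hf.1 α (h0 h), fun α h => hf.2.1 (h0 h), fun σ hσ α hα => ?_⟩
  have : σ.map (algebraMap F F) = σ := by ext; rfl
  rw [this, coeff_subst_mapCoeff, coeff_mapCoeff, hf.2.2 σ hσ α hα]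

/-- The coordinates of an invariant in a basis of K over F are invariants over F, since the matrices
have entries in F. Hence an F-basis of the invariants over F spans those over K. -/
theorem finrank_redInv_le_base [FiniteDimensional F K] (Q n d : ℕ) :
    Module.finrank K (redInv F K Q n d) ≤ Module.finrank F (redInv F F Q n d) := by
  let b := Module.finBasis F K
  let e := Module.finBasis F (redInv F F Q n d)
  let w (i : Fin (Module.finrank F (redInv F F Q n d))) : MvPolynomial (Fin n) K :=
    map (algebraMap F K) (e i : MvPolynomial (Fin n) F)
  have hw : ∀ g ∈ redInv F F Q n d, map (algebraMap F K) g ∈ Submodule.span K (Set.range w) := by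
    intro g hg
    have h1 := congrArg Subtype.val (e.sum_repr ⟨g, hg⟩)
    simp only [Submodule.coe_sum, Submodule.coe_smul] at h1
    rw [← h1, map_sum]
    refine Submodule.sum_mem _ fun i _ => ?_
    rw [smul_eq_C_mul, map_mul, map_C, ← smul_eq_C_mul]
    exact Submodule.smul_mem _ _ (Submodule.subset_span ⟨i, rfl⟩)
  have hle : redInv F K Q n d ≤ Submodule.span K (Set.range w) := by
    intro f hf
    have hf' : f = ∑ s, C (b s) * map (algebraMap F K) (mapCoeff (b.coord s) f) := by
      ext α
      rw [coeff_sum]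
      conv_lhs => rw [← b.sum_repr (coeff α f)]
      refine Finset.sum_congr rfl fun s _ => ?_
      rw [coeff_C_mul, coeff_map, coeff_mapCoeff, Module.Basis.coord_apply, Algebra.smul_def,
        mul_comm]
    rw [hf']
    refine Submodule.sum_mem _ fun s _ => ?_
    rw [← smul_eq_C_mul]
    exact Submodule.smul_mem _ _ (hw _ (mapCoeff_mem_redInv _ hf))
  have := FiniteDimensional.span_of_finite K (Set.finite_range w)
  exact (Submodule.finrank_mono hle).trans ((finrank_range_le_card w).trans (by simp))

end BaseChange

/-! ## The Hilbert series -/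

theorem isUpper_of_mem_borel {F : Type*} [Field F] {n : ℕ}
    {σ : Matrix.GeneralLinearGroup (Fin n) F} (hσ : σ ∈ borel F n) :
    IsUpper (σ : Matrix (Fin n) (Fin n) F) := by
  refine ⟨hσ, fun i h0 => ?_⟩
  have h1 : (σ : Matrix (Fin n) (Fin n) F).det = ∏ i, σ.1 i i :=
    Matrix.det_of_isUpperTriangular fun i j h => hσ i j h
  have h2 : (σ : Matrix (Fin n) (Fin n) F).det ≠ 0 :=
    ((Matrix.isUnit_iff_isUnit_det _).1 σ.isUnit).ne_zero
  exact h2 (h1.trans (Finset.prod_eq_zero (Finset.mem_univ i) h0))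

theorem IsUpper.exists_mem_borel {F : Type*} [Field F] {n : ℕ} {σ : Matrix (Fin n) (Fin n) F}
    (hσ : IsUpper σ) :
    ∃ g ∈ borel F n, (g : Matrix (Fin n) (Fin n) F) = σ := by
  have h1 : σ.det = ∏ i, σ i i := Matrix.det_of_isUpperTriangular fun i j h => hσ.1 i j h
  have h2 : σ.det ≠ 0 := by
    rw [h1]
    exact Finset.prod_ne_zero_iff.2 fun i _ => hσ.2 i
  exact ⟨Matrix.GeneralLinearGroup.mkOfDetNeZero σ h2, hσ.1, rfl⟩

section Hilbert

variable (F : Type*) [Field F] [Fintype F] (m n : ℕ)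

theorem eval_one_borelPoly_le_sum_base {D : ℕ} (hD : n * Fintype.card F ^ m ≤ D) :
    (borelPoly (Fintype.card F) n m).eval 1 ≤
      ∑ d ∈ Finset.range (D + 1), Module.finrank F (redInv F F (Fintype.card F ^ m) n d) := by
  -- No extension has degree 0; for m = 0 the bound is 1 and the constant polynomial 1 attains it.
  rcases Nat.eq_zero_or_pos m with rfl | hm
  · have h1 : (borelPoly (Fintype.card F) n 0) = 1 := by
      clear hD
      induction n with
      | zero => rfl
      | succ n ih => rw [borelPoly, ih]
    have h2 : (1 : MvPolynomial (Fin n) F) ∈ redInv F F (Fintype.card F ^ 0) n 0 := by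
      refine ⟨fun α h i => ?_, isHomogeneous_one _ _, fun σ _ α _ => by rw [map_one]⟩
      rw [coeff_one] at h
      have : α = 0 := by
        by_contra h0
        exact h (if_neg (Ne.symm h0))
      simp [this]
    have h3 : 1 ≤ Module.finrank F (redInv F F (Fintype.card F ^ 0) n 0) := by
      rw [Nat.one_le_iff_ne_zero, Ne, Submodule.finrank_eq_zero]
      intro h
      rw [h, Submodule.mem_bot] at h2
      exact one_ne_zero h2
    rw [h1, Polynomial.eval_one, Finset.sum_range_succ']
    omega
  · obtain ⟨p, hp⟩ := CharP.exists F
    obtain ⟨r, hprime, hr⟩ := FiniteField.card F p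
    have : Fact p.Prime := ⟨hprime⟩
    have : NeZero m := ⟨hm.ne'⟩
    let K := FiniteField.Extension F p m
    have : Fintype K := Fintype.ofFinite K
    have hK : Fintype.card K = Fintype.card F ^ m := by
      rw [← Nat.card_eq_fintype_card, ← Nat.card_eq_fintype_card, FiniteField.natCard_extension]
    have h := eval_one_borelPoly_le_sum (F := F) (K := K) (n := n) (D := D)
      (FiniteField.finrank_extension F p m) (by rwa [hK])
    rw [hK] at h
    exact h.trans (Finset.sum_le_sum fun d _ => finrank_redInv_le_base _ _ _)

theorem finrank_redInv_eq (d : ℕ) :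
    Module.finrank F (redInv F F (Fintype.card F ^ m) n d) =
      (borelPoly (Fintype.card F) n m).coeff d := by
  set P := borelPoly (Fintype.card F) n m with hP
  -- Large enough for the orbit bound, for all coefficients of P, and to include the degree d.
  let D := n * Fintype.card F ^ m + P.natDegree + d
  have hle (i : ℕ) := finrank_redInv_le F F n m i
  refine ((Finset.sum_eq_sum_iff_of_le (s := Finset.range (D + 1)) fun i _ => hle i).1 ?_) d
    (Finset.mem_range.2 (by omega))
  refine le_antisymm (Finset.sum_le_sum fun i _ => hle i) ?_
  have h1 : P.eval 1 = ∑ i ∈ Finset.range (D + 1), P.coeff i := by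
    rw [Polynomial.eval_eq_sum_range' (n := D + 1) (by omega)]
    simp
  rw [← hP, ← h1]
  exact eval_one_borelPoly_le_sum_base F m n (by omega)

/-! ### Reduced representatives in the truncated ring -/

variable {F m n}

/-- The ideal is monomial, so membership is tested on each monomial separately. -/
theorem mem_truncIdeal_iff {f : MvPolynomial (Fin n) F} :
    f ∈ truncIdeal F m n ↔
      ∀ α : Fin n →₀ ℕ, (∀ i, α i < Fintype.card F ^ m) → coeff α f = 0 := by
  have h : truncIdeal F m n = Ideal.span ((fun s => monomial s (1 : F)) ''
      Set.range fun i : Fin n => Finsupp.single i (Fintype.card F ^ m)) := by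
    rw [truncIdeal, ← Set.range_comp]
    congr 2
    funext i
    exact X_pow_eq_monomial
  rw [h, mem_ideal_span_monomial_image]
  refine forall_congr' fun α => ?_
  rw [mem_support_iff, not_imp_comm]
  simp only [Set.exists_range_iff, Finsupp.single_le_iff, not_exists, not_le]

theorem mk_mem_borelInvariants_iff (f : MvPolynomial (Fin n) F) :
    Ideal.Quotient.mk (truncIdeal F m n) f ∈ borelInvariants F m n ↔
      ∀ σ : Matrix (Fin n) (Fin n) F, IsUpper σ →
        ∀ α : Fin n →₀ ℕ, (∀ i, α i < Fintype.card F ^ m) →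
          coeff α (subst σ f) = coeff α f := by
  have key (σ : Matrix (Fin n) (Fin n) F) :
      truncSubst m σ (Ideal.Quotient.mk (truncIdeal F m n) f) =
        Ideal.Quotient.mk (truncIdeal F m n) f ↔
      ∀ α : Fin n →₀ ℕ, (∀ i, α i < Fintype.card F ^ m) →
          coeff α (subst σ f) = coeff α f := by
    rw [truncSubst_mk, Ideal.Quotient.eq, mem_truncIdeal_iff]
    simp only [coeff_sub, sub_eq_zero]
  constructor
  · intro h σ hσ
    obtain ⟨g, hg, rfl⟩ := hσ.exists_mem_borel
    exact (key _).1 (h ⟨g, hg⟩)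
  · intro h g
    exact (key _).2 (h _ (isUpper_of_mem_borel g.2))

theorem exists_reduced (f : MvPolynomial (Fin n) F) {d : ℕ} (hf : f.IsHomogeneous d) :
    ∃ g : MvPolynomial (Fin n) F, (∀ α, coeff α g ≠ 0 → ∀ i, α i < Fintype.card F ^ m) ∧
      g.IsHomogeneous d ∧
      Ideal.Quotient.mk (truncIdeal F m n) g = Ideal.Quotient.mk (truncIdeal F m n) f := by
  classical
  let g : MvPolynomial (Fin n) F :=
    ∑ α ∈ f.support.filter (fun α => ∀ i, α i < Fintype.card F ^ m), monomial α (coeff α f)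
  have hg (α : Fin n →₀ ℕ) :
      coeff α g = if ∀ i, α i < Fintype.card F ^ m then coeff α f else 0 := by
    simp only [g, coeff_sum, coeff_monomial, Finset.sum_ite_eq', Finset.mem_filter]
    by_cases h1 : ∀ i, α i < Fintype.card F ^ m
    · by_cases h2 : α ∈ f.support
      · rw [if_pos ⟨h2, h1⟩, if_pos h1]
      · rw [if_neg fun h => h2 h.1, if_pos h1, notMem_support_iff.1 h2]
    · rw [if_neg fun h => h1 h.2, if_neg h1]
  refine ⟨g, fun α h => ?_, fun α h => ?_, ?_⟩
  · by_contra h1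
    exact h ((hg α).trans (if_neg h1))
  · refine hf fun h0 => h ?_
    rw [hg, h0, ite_self]
  · rw [Ideal.Quotient.eq, mem_truncIdeal_iff]
    intro α hα
    rw [coeff_sub, hg, if_pos hα, sub_self]

/-- Dropping the monomials in the ideal gives each class a unique reduced representative and
preserves homogeneity. -/
theorem finrank_borelInvariants_inf (d : ℕ) :
    Module.finrank F ↥(borelInvariants F m n ⊓ truncDegree F m n d) =
      Module.finrank F (redInv F F (Fintype.card F ^ m) n d) := by
  let π : MvPolynomial (Fin n) F →ₗ[F] TruncRing F m n :=
    (Ideal.Quotient.mkₐ F (truncIdeal F m n)).toLinearMap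
  have hπ (f) : π f = Ideal.Quotient.mk (truncIdeal F m n) f := rfl
  have hid (σ : Matrix (Fin n) (Fin n) F) : σ.map (algebraMap F F) = σ := by ext; rfl
  have hrange : LinearMap.range (π.domRestrict (redInv F F (Fintype.card F ^ m) n d)) =
      borelInvariants F m n ⊓ truncDegree F m n d := by
    ext x
    constructor
    · rintro ⟨⟨f, hf⟩, rfl⟩
      refine ⟨(mk_mem_borelInvariants_iff f).2 fun σ hσ => ?_, ⟨f, hf.2.1, rfl⟩⟩
      have := hf.2.2 σ hσ
      rwa [hid] at this
    · rintro ⟨h1, f, hf, rfl⟩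
      obtain ⟨g, g1, g2, g3⟩ := exists_reduced (m := m) f hf
      refine ⟨⟨g, g1, g2, fun σ hσ => ?_⟩, g3⟩
      have h2 : Ideal.Quotient.mk (truncIdeal F m n) g ∈ borelInvariants F m n := by
        rw [g3]
        exact h1
      rw [hid]
      exact (mk_mem_borelInvariants_iff g).1 h2 σ hσ
  rw [← hrange]
  refine LinearMap.finrank_range_of_inj ?_
  rw [← LinearMap.ker_eq_bot, Submodule.eq_bot_iff]
  rintro ⟨f, hf⟩ hx
  have h1 : Ideal.Quotient.mk (truncIdeal F m n) f = 0 := hx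
  rw [Ideal.Quotient.eq_zero_iff_mem, mem_truncIdeal_iff] at h1
  refine Subtype.ext (MvPolynomial.ext _ _ fun α => ?_)
  by_contra h
  exact h (h1 α (hf.1 α h))

end Hilbert

end BorelTrunc

end

theorem mainTheorem2 (F : Type*) [Field F] [Fintype F] (m n : ℕ) (hn : 1 ≤ n) :
    BorelTrunc.hilbertSeries (BorelTrunc.borelInvariants F m n) =
      BorelTrunc.parabolicSeries (Fintype.card F) m (fun _ : Fin n => 1) := by
  rw [BorelTrunc.parabolicSeries_one Fintype.one_lt_card]
  ext d
  rw [BorelTrunc.hilbertSeries, PowerSeries.coeff_mk, PowerSeries.coeff_mk,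
    BorelTrunc.finrank_borelInvariants_inf, BorelTrunc.finrank_redInv_eq]
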